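/- **Asymptotic symmetry algebra of spin-2 Carroll gravity.** Let $\mathfrak{car}$ be the real Lie algebra with basis $H,P_a,J,G_a$ ($a=1,2$) and non-vanishing brackets $[J,P_a]=\epsilon_{ab}P_b$, $[J,G_a]=\epsilon_{ab}G_b$, $[P_a,G_b]=-\epsilon_{ab}H$, where $\epsilon_{12}=1=-\epsilon_{21}$, $\epsilon_{11}=\epsilon_{22}=0$ and repeated indices are summed. Equip it with the invariant metric $\langle H,J\rangle=-1$, $\langle P_a,G_b\rangle=\delta_{ab}$ (other entries zero). Consider Chern–Simons theory for $\mathfrak{car}$ at level $k\in\mathbb R\setminus\{0\}$, with field equations $F=dA+A\wedge A=0$, in coordinates $(t,\rho,\varphi)$, $\varphi\sim\varphi+2\pi$; all fields and gauge parameters are smooth and $2\pi$-periodic in $\varphi$. Fix a smooth real function $\mu(t,\varphi)$, $2\pi$-periodic in $\varphi$, and impose the boundary conditions $$A=b^{-1}(d+a)b,\quad b=e^{\rho P_2},\quad a_t=\mu H,\quad a_\varphi=-J+hH+p_aP_a+g_aG_a,$$ where $h,p_a,g_a$ are arbitrary functions of $(t,\varphi)$; the allowed variations are $\delta a=(\delta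 h\,H+\delta p_a P_a+\delta g_a G_a)\,d\varphi$, with $\delta b=0$ and $\delta\mu=0$. 1. (Canonical charges.) Let $A,\delta A$ be arbitrary $\mathfrak{car}$-valued one-forms and $\Lambda$ a $\mathfrak{car}$-valued function. On the part $r\le\rho\le R$ of a slice of constant $t$, the derivative of $-\frac{k}{2\pi}\int\langle\Lambda,F_{\rho\varphi}\rangle\,d\rho\,d\varphi$ in the direction $\delta A$ is $\Omega(d\Lambda+[A,\Lambda],\delta A)-\delta Q_R+\delta Q_r$, where $\Omega(\delta_1A,\delta_2A)=\frac{k}{2\pi}\int(\langle\delta_1A_\rho,\delta_2A_\varphi\rangle-\langle\delta_1A_\varphi,\delta_2A_\rho\rangle)\,d\rho\,d\varphi$ and $\delta Q_\rho=\frac{k}{2\pi}\oint\langle\Lambda,\delta A_\varphi\rangle\,d\varphi$ on the circle of radius $\rho$; thus $\delta Q_\rho$ is the variation of the canonical boundary charge. 2. (Solutions.) A connection obeying the boundary conditions satisfies $F=0$ if and only if $\partial_tp_a=\partial_tg_a=0$ and $\partial_th=\partial_\varphi\mu$. 3. (Symmetries.) For a state-independent $\Lambda(t,\varphi)$ the gauge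 transformation $\delta A=d\hat\Lambda+[A,\hat\Lambda]$ with $\hat\Lambda=b^{-1}\Lambda b$ preserves the boundary conditions if and only if $\partial_t\Lambda=0$ and $\partial_\varphi\Lambda^J=0$. It then acts by $\delta_\Lambda a_\varphi=\partial_\varphi\Lambda+[a_\varphi,\Lambda]$, and $a_\varphi+\varepsilon\,\delta_\Lambda a_\varphi$ satisfies $F=0$ for every $\varepsilon\in\mathbb R$ if $a_\varphi$ does. 4. (Charges.) For every such $\Lambda$ and every allowed variation, $\delta Q_\rho[\hat\Lambda]$ does not depend on $\rho$, so it is finite as $\rho\to\infty$, and it is the variation of $Q[\Lambda]=\frac{k}{2\pi}\oint(-\Lambda^Jh+\Lambda^{P_a}g_a+\Lambda^{G_a}p_a)\,d\varphi$ (integrability). On solutions $Q[\Lambda]$ is independent of $t$ (conservation), and it is constant on the space of solutions if and only if $\Lambda^J=\Lambda^{P_a}=\Lambda^{G_a}=0$ (non-triviality). 5. (Algebra.) On the complex vector space of functionals on the space of solutions spanned by the constants and the charges $Q[\Lambda]$ there is exactly one Lie bracket (the Dirac bracket, here written as the commutator) for which the charges generate the gauge transformations, $[Q[\Lambda],F]=\delta_\Lambda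 F$. Put $$X_n=\frac{k}{2\pi}\oint e^{-in\varphi}\langle X,a_\varphi\rangle\,d\varphi ,$$ so that on solutions $P^a_n=\frac{k}{2\pi}\oint e^{-in\varphi}g_a\,d\varphi$ and $G^a_n=\frac{k}{2\pi}\oint e^{-in\varphi}p_a\,d\varphi$ ($n\in\mathbb Z$), and, for $n=0$, $J=-\frac{k}{2\pi}\oint h\,d\varphi$ and $H=k$ (a constant). These functionals belong to the above space and are linearly independent. They exhaust the charges: $Q[\Lambda]=\Lambda^JJ+\sum_{n\in\mathbb Z}(\Lambda^{P_a}_nP^a_n+\Lambda^{G_a}_nG^a_n)$ on every solution, where $\Lambda^X_n=\frac1{2\pi}\oint e^{in\varphi}\Lambda^X\,d\varphi$. They satisfy $$[J,P^a_n]=\epsilon_{ab}P^b_n,\qquad [J,G^a_n]=\epsilon_{ab}G^b_n,\qquad [P^a_n,G^b_m]=-(\epsilon_{ab}+in\,\delta_{ab})\,H\,\delta_{n+m,0},$$ and all other commutators vanish; in particular $H$ is central. Hence the asymptotic symmetry algebra is an infinite-dimensional extension of the Carroll algebra: $H\mapsto H$, $J\mapsto J$, $P_a\mapsto P^a_0$,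 $G_a\mapsto G^a_0$ defines an injective homomorphism of Lie algebras from the complexified Carroll algebra. -/

import Mathlib

open Filter Topology
open scoped ContDiff

/-! ## The Carroll algebra in three dimensions, with its invariant metric -/

/-- Generators of the spin-2 Carroll algebra. The index values `0, 1 : Fin 2` stand for the spatial
indices 1, 2. -/
inductive CarrollGen : Type
  | H : CarrollGen
  | P : Fin 2 → CarrollGen
  | J : CarrollGen
  | G : Fin 2 → CarrollGen
  deriving DecidableEq

/-- The antisymmetric symbol with `ε₁₂ = 1`. -/
def eps {R : Type*} [CommRing R] (a b : Fin 2) : R :=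
  (!![0, 1; -1, 0] : Matrix (Fin 2) (Fin 2) R) a b

/-- The Carroll algebra over `R`: an element is given by its coefficients with respect to the
generators. -/
@[ext] structure Carroll (R : Type*) where
  coeff : CarrollGen → R

namespace Carroll

variable {R : Type*} [CommRing R]

instance : CoeFun (Carroll R) (fun _ => CarrollGen → R) := ⟨Carroll.coeff⟩

instance : Zero (Carroll R) := ⟨⟨0⟩⟩

instance : Add (Carroll R) := ⟨fun x y => ⟨fun i => x i + y i⟩⟩

instance : Neg (Carroll R) := ⟨fun x => ⟨fun i => -x i⟩⟩

instance : Sub (Carroll R) := ⟨fun x y => ⟨fun i => x i - y i⟩⟩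

instance {S : Type*} [SMul S R] : SMul S (Carroll R) := ⟨fun c x => ⟨fun i => c • x i⟩⟩

theorem coeff_injective {R : Type*} :
    Function.Injective (Carroll.coeff : Carroll R → CarrollGen → R) :=
  fun _ _ h => Carroll.ext h

instance : AddCommGroup (Carroll R) :=
  coeff_injective.addCommGroup _ rfl (fun _ _ => rfl) (fun _ => rfl) (fun _ _ => rfl)
    (fun _ _ => rfl) (fun _ _ => rfl)

instance {S : Type*} [Semiring S] [Module S R] : Module S (Carroll R) :=
  coeff_injective.module S
    { toFun := Carroll.coeff, map_zero' := rfl, map_add' := fun _ _ => rfl } (fun _ _ => rfl)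

instance {S S' : Type*} [SMul S R] [SMul S' R] [SMulCommClass S S' R] :
    SMulCommClass S S' (Carroll R) :=
  ⟨fun c c' x => Carroll.ext (funext fun i => smul_comm c c' (x i))⟩

/-- The basis vector belonging to a generator. -/
def gen (X : CarrollGen) : Carroll R := ⟨fun Y => if Y = X then 1 else 0⟩

/-- The bilinear bracket with `[J, P_a] = ε_ab P_b`, `[J, G_a] = ε_ab G_b`, `[P_a, G_b] = -ε_ab H`
(all other brackets of generators vanish). -/
instance : Bracket (Carroll R) (Carroll R) where
  bracket x y := ⟨fun
    | .H => -∑ a, ∑ b, eps a b * (x (.P a) * y (.G b) - y (.P a) * x (.G b))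
    | .P b => ∑ a, eps a b * (x .J * y (.P a) - y .J * x (.P a))
    | .J => 0
    | .G b => ∑ a, eps a b * (x .J * y (.G a) - y .J * x (.G a))⟩

@[simp] theorem add_coeff (x y : Carroll R) (i : CarrollGen) : (x + y) i = x i + y i := rfl

@[simp] theorem smul_coeff (c : R) (x : Carroll R) (i : CarrollGen) : (c • x) i = c * x i := rfl

@[simp] theorem neg_coeff (x : Carroll R) (i : CarrollGen) : (-x) i = -x i := rfl

@[simp] theorem zero_coeff (i : CarrollGen) : (0 : Carroll R) i = 0 := rfl

theorem bracket_H (x y : Carroll R) : ⁅x, y⁆ .H =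
    -∑ a, ∑ b, eps a b * (x (.P a) * y (.G b) - y (.P a) * x (.G b)) := rfl

theorem bracket_P (x y : Carroll R) (b : Fin 2) : ⁅x, y⁆ (.P b) =
    ∑ a, eps a b * (x .J * y (.P a) - y .J * x (.P a)) := rfl

theorem bracket_J (x y : Carroll R) : ⁅x, y⁆ .J = 0 := rfl

theorem bracket_G (x y : Carroll R) (b : Fin 2) : ⁅x, y⁆ (.G b) =
    ∑ a, eps a b * (x .J * y (.G a) - y .J * x (.G a)) := rfl

instance : LieRing (Carroll R) where
  add_lie x y z := by
    ext i
    rcases i with _ | b | _ | b <;>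
      simp [bracket_H, bracket_P, bracket_J, bracket_G, eps, Fin.sum_univ_two] <;>
      (try fin_cases b) <;> (try simp) <;> (try ring)
  lie_add x y z := by
    ext i
    rcases i with _ | b | _ | b <;>
      simp [bracket_H, bracket_P, bracket_J, bracket_G, eps, Fin.sum_univ_two] <;>
      (try fin_cases b) <;> (try simp) <;> (try ring)
  lie_self x := by
    ext i
    rcases i with _ | b | _ | b <;>
      simp [bracket_H, bracket_P, bracket_J, bracket_G, eps]
  leibniz_lie x y z := by
    ext i
    rcases i with _ | b | _ | b <;>
      simp [bracket_H, bracket_P, bracket_J, bracket_G, eps, Fin.sum_univ_two] <;>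
      (try fin_cases b) <;> (try simp) <;> (try ring)

instance : LieAlgebra R (Carroll R) where
  lie_smul c x y := by
    ext i
    rcases i with _ | b | _ | b <;>
      simp [bracket_H, bracket_P, bracket_J, bracket_G, eps, Fin.sum_univ_two] <;>
      (try fin_cases b) <;> (try simp) <;> (try ring)

/-- The invariant metric: `⟨H, J⟩ = -1`, `⟨P_a, G_b⟩ = δ_ab`, all other entries vanish. -/
def metric (x y : Carroll R) : R :=
  -(x .H * y .J + x .J * y .H) + ∑ a, (x (.P a) * y (.G a) + x (.G a) * y (.P a))

end Carroll

noncomputable section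

/-! ## Fields in the bulk, in coordinates `x 0 = t`, `x 1 = ρ`, `x 2 = φ` -/

/-- A Lie algebra valued function on spacetime. -/
abbrev BulkField : Type := (Fin 3 → ℝ) → Carroll ℝ

/-- A Lie algebra valued one-form, given by its components `A_t, A_ρ, A_φ`. -/
abbrev OneForm : Type := Fin 3 → BulkField

/-- The partial derivative in direction `i`. -/
def BulkField.pd (i : Fin 3) (f : BulkField) : BulkField :=
  fun x => ⟨fun X => lineDeriv ℝ (fun y => f y X) x (Pi.single i 1)⟩

/-- Smoothness, and `2π`-periodicity in the angle `φ`. -/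
def BulkField.SmoothPeriodic (f : BulkField) : Prop :=
  (∀ X, ContDiff ℝ ∞ (fun x => f x X)) ∧
    ∀ t ρ φ : ℝ, f ![t, ρ, φ + 2 * Real.pi] = f ![t, ρ, φ]

/-- The components `F_ij = ∂_i A_j - ∂_j A_i + [A_i, A_j]` of the field strength `F = dA + A ∧ A`. -/
def fieldStrength (A : OneForm) (i j : Fin 3) : BulkField :=
  fun x => (A j).pd i x - (A i).pd j x + ⁅A i x, A j x⁆

/-- The infinitesimal gauge transformation `δA = dΛ + [A, Λ]`. -/
def gaugeVariation (A : OneForm) (Λ : BulkField) : OneForm :=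
  fun i x => Λ.pd i x + ⁅A i x, Λ x⁆

/-- The symplectic form `(k/2π) ∫ (⟨δ₁A_ρ, δ₂A_φ⟩ - ⟨δ₁A_φ, δ₂A_ρ⟩)` of Chern-Simons theory at
level `k`, on the part `r ≤ ρ ≤ R` of the slice of constant time `t`. -/
def symplecticForm (k t r R : ℝ) (δ₁ δ₂ : OneForm) : ℝ :=
  k / (2 * Real.pi) * ∫ ρ in r..R, ∫ φ in (0 : ℝ)..(2 * Real.pi),
    (Carroll.metric (δ₁ 1 ![t, ρ, φ]) (δ₂ 2 ![t, ρ, φ])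
      - Carroll.metric (δ₁ 2 ![t, ρ, φ]) (δ₂ 1 ![t, ρ, φ]))

/-- The smeared Gauss constraint `-(k/2π) ∫ ⟨Λ, F_ρφ⟩` of Chern-Simons theory at level `k`, on the
part `r ≤ ρ ≤ R` of the slice of constant time `t`. -/
def smearedConstraint (k t r R : ℝ) (Λ : BulkField) (A : OneForm) : ℝ :=
  -(k / (2 * Real.pi)) * ∫ ρ in r..R, ∫ φ in (0 : ℝ)..(2 * Real.pi),
    Carroll.metric (Λ ![t, ρ, φ]) (fieldStrength A 1 2 ![t, ρ, φ])

/-- The variation `(k/2π) ∮ ⟨Λ, δA⟩` of the canonical boundary charge, on the circle of radius `ρ`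
at time `t`. -/
def chargeVariation (k t ρ : ℝ) (Λ : BulkField) (δA : OneForm) : ℝ :=
  k / (2 * Real.pi) * ∫ φ in (0 : ℝ)..(2 * Real.pi),
    Carroll.metric (Λ ![t, ρ, φ]) (δA 2 ![t, ρ, φ])

/-! ## The boundary conditions -/

/-- A Lie algebra valued function of `(t, φ)`. -/
abbrev BoundaryField : Type := ℝ → ℝ → Carroll ℝ

/-- Smoothness, and `2π`-periodicity in the angle `φ`. -/
def BoundaryField.SmoothPeriodic (f : BoundaryField) : Prop :=
  (∀ X, ContDiff ℝ ∞ (fun z : ℝ × ℝ => f z.1 z.2 X)) ∧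
    ∀ t φ : ℝ, f t (φ + 2 * Real.pi) = f t φ

/-- Conjugation `X ↦ b⁻¹ X b` by the group element `b = exp (ρ P₂)`, that is
`exp (-ρ ad P₂)`, where `ad P₂` is nilpotent. -/
def radialConj (ρ : ℝ) : Carroll ℝ →ₗ[ℝ] Carroll ℝ :=
  IsNilpotent.exp ((-ρ) • (LieAlgebra.ad ℝ (Carroll ℝ) (Carroll.gen (.P 1)) :
    Module.End ℝ (Carroll ℝ)))

/-- The bulk function `b⁻¹ f b` with `b = exp (ρ P₂)`. -/
def dressed (f : BoundaryField) : BulkField := fun x => radialConj (x 1) (f (x 0) (x 2))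

/-- `a_φ` is allowed by the boundary conditions: it is smooth, periodic and of the form
`a_φ = -J + h H + p_a P_a + g_a G_a`, with `h`, `p_a`, `g_a` arbitrary functions of `(t, φ)`. -/
def IsState (a : BoundaryField) : Prop := a.SmoothPeriodic ∧ ∀ t φ, a t φ .J = -1

/-- The allowed variations `δa_φ = δh H + δp_a P_a + δg_a G_a`. -/
def IsVariation (δ : BoundaryField) : Prop := δ.SmoothPeriodic ∧ ∀ t φ, δ t φ .J = 0

/-- The full connection `A = b⁻¹ (d + a) b` with `b = exp (ρ P₂)` (so `b⁻¹ db = P₂ dρ`) and the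
boundary connection `a = a_φ dφ + μ H dt`. -/
def connection (μ : ℝ → ℝ → ℝ) (a : BoundaryField) : OneForm :=
  ![dressed (fun t φ => μ t φ • Carroll.gen .H), fun _ => Carroll.gen (.P 1), dressed a]

/-- The variation `δA = b⁻¹ (δa_φ dφ) b` of the connection under `a_φ ↦ a_φ + δa_φ`, where
`δb = 0` and `δμ = 0`. -/
def connectionVariation (δ : BoundaryField) : OneForm := ![0, 0, dressed δ]

/-- `a_φ` is allowed by the boundary conditions and solves the Chern-Simons field equations
`F = 0`. -/
def OnShell (μ : ℝ → ℝ → ℝ) (a : BoundaryField) : Prop :=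
  IsState a ∧ ∀ i j x, fieldStrength (connection μ a) i j x = 0

/-- The gauge transformations generated by `b⁻¹ Λ b` preserve the boundary conditions. The
parameter `Λ(t, φ)` does not depend on the state. -/
def Admissible (μ : ℝ → ℝ → ℝ) (Λ : BoundaryField) : Prop :=
  Λ.SmoothPeriodic ∧ ∀ a, IsState a →
    ∃ δ, IsVariation δ ∧ gaugeVariation (connection μ a) (dressed Λ) = connectionVariation δ

/-- The variation `δ_Λ a_φ = ∂_φ Λ + [a_φ, Λ]` of a boundary connection. -/
def boundaryVariation (Λ a : BoundaryField) : BoundaryField :=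
  fun t φ => ⟨fun X => deriv (fun u => Λ t u X) φ⟩ + ⁅a t φ, Λ t φ⁆

/-- The boundary charge
`Q[Λ] = (k/2π) ∮ (-Λ^J h + Λ^{P_a} g_a + Λ^{G_a} p_a) dφ`, evaluated at time `t`. -/
def charge (k : ℝ) (Λ : BoundaryField) (t : ℝ) (a : BoundaryField) : ℝ :=
  k / (2 * Real.pi) * ∫ φ in (0 : ℝ)..(2 * Real.pi),
    (-(Λ t φ .J * a t φ .H)
      + ∑ c, (Λ t φ (.P c) * a t φ (.G c) + Λ t φ (.G c) * a t φ (.P c)))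

/-! ## The algebra of the charges -/

/-- The space of all states on shell. -/
abbrev SolutionSpace (μ : ℝ → ℝ → ℝ) : Type := {a : BoundaryField // OnShell μ a}

/-- The charge `Q[Λ]` as a functional on the space of solutions, evaluated at `t = 0`. -/
def chargeFunctional (μ : ℝ → ℝ → ℝ) (k : ℝ) (Λ : BoundaryField) : SolutionSpace μ → ℂ :=
  fun a => (charge k Λ 0 a.1 : ℂ)

/-- The complex vector space of functionals spanned by the charges of all boundary condition
preserving gauge transformations and the constants. -/
def ChargeSpace (μ : ℝ → ℝ → ℝ) (k : ℝ) : Submodule ℂ (SolutionSpace μ → ℂ) :=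
  Submodule.span ℂ ({1} ∪ {F | ∃ Λ, Admissible μ Λ ∧ F = chargeFunctional μ k Λ})

/-- `F' = δ_Λ F`: the functional `F'` is the derivative of `F` along the gauge variation
`a ↦ a + ε δ_Λ a`. -/
def HasGaugeVariation (μ : ℝ → ℝ → ℝ) (Λ : BoundaryField) (F F' : SolutionSpace μ → ℂ) : Prop :=
  ∀ (a : SolutionSpace μ) (c : ℝ → SolutionSpace μ),
    (∀ ε, (c ε).1 = a.1 + ε • boundaryVariation Λ a.1) →
      HasDerivAt (fun ε => F (c ε)) (F' a) 0

/-- The Dirac bracket of the charges: a Lie bracket for which the charges generate the gauge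
transformations, `{Q[Λ], F} = δ_Λ F`. -/
structure IsDiracBracket (μ : ℝ → ℝ → ℝ) (k : ℝ)
    (br : ChargeSpace μ k →ₗ[ℂ] ChargeSpace μ k →ₗ[ℂ] ChargeSpace μ k) : Prop where
  alternating : ∀ F, br F F = 0
  jacobi : ∀ F₁ F₂ F₃, br F₁ (br F₂ F₃) = br (br F₁ F₂) F₃ + br F₂ (br F₁ F₃)
  generates : ∀ (Λ : BoundaryField), Admissible μ Λ → ∀ Q : ChargeSpace μ k,
    (Q : SolutionSpace μ → ℂ) = chargeFunctional μ k Λ →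
      ∀ F : ChargeSpace μ k, HasGaugeVariation μ Λ F (br Q F)

/-- The Fourier mode `X_n = (k/2π) ∮ e^{-inφ} ⟨X, a_φ⟩ dφ` belonging to the generator `X` of the
Carroll algebra, evaluated at `t = 0`. By the form of the metric, `⟨P_a, a_φ⟩ = g_a`,
`⟨G_a, a_φ⟩ = p_a`, `⟨J, a_φ⟩ = -h` and `⟨H, a_φ⟩ = 1`. -/
def chargeMode (μ : ℝ → ℝ → ℝ) (k : ℝ) (X : CarrollGen) (n : ℤ) : SolutionSpace μ → ℂ :=
  fun a => ((k / (2 * Real.pi) : ℝ) : ℂ) * ∫ φ in (0 : ℝ)..(2 * Real.pi),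
    Complex.exp (-(Complex.I * n * φ)) * ((Carroll.metric (Carroll.gen X) (a.1 0 φ) : ℝ) : ℂ)

/-- The coefficient of `e^{-inφ}` in the Fourier expansion of the component of `Λ` along the
generator `X` at `t = 0`. -/
def parameterMode (Λ : BoundaryField) (X : CarrollGen) (n : ℤ) : ℂ :=
  ((1 / (2 * Real.pi) : ℝ) : ℂ) * ∫ φ in (0 : ℝ)..(2 * Real.pi),
    Complex.exp (Complex.I * n * φ) * ((Λ 0 φ X : ℝ) : ℂ)

/-- Labels of the generators `H`, `J`, `P^a_n`, `G^a_n` of the asymptotic symmetry algebra. -/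
inductive AsymptoticGen : Type
  | H : AsymptoticGen
  | J : AsymptoticGen
  | P : Fin 2 → ℤ → AsymptoticGen
  | G : Fin 2 → ℤ → AsymptoticGen

/-- The generators as functionals on the space of solutions. -/
def asymptoticCharge (μ : ℝ → ℝ → ℝ) (k : ℝ) : AsymptoticGen → SolutionSpace μ → ℂ
  | .H => chargeMode μ k .H 0
  | .J => chargeMode μ k .J 0
  | .P a n => chargeMode μ k (.P a) n
  | .G a n => chargeMode μ k (.G a) n

end

/-! Everything radial is pure conjugation. Since `(ad P₂)² = 0`, conjugation by `b` is affine in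
`ρ`; it is an automorphism preserving the metric, and its `ρ`-derivative cancels the bracket with
`A_ρ = P₂`. So `F_tρ` and `F_ρφ` vanish identically. As `H` is central, `F_tφ` is the conjugate of
`∂_t a_φ - ∂_φ μ H`, and the gauge variation of the connection is the conjugate of `∂_t Λ` in `dt`
and of `∂_φ Λ + [a_φ, Λ]` in `dφ` (`fieldStrength_connection_time_angular`,
`gaugeVariation_connection`). This gives the solutions and the symmetries.

The charges come from an integration by parts: `d⟨Λ, δA⟩ = ⟨D_A Λ, δA⟩ + ⟨Λ, D_A δA⟩` by invariance
of the metric, and the divergence theorem leaves only the two circles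
(`hasDerivAt_smearedConstraint`). Conservation holds because only `-Λ^J h` depends on time in the
charge density, and its time derivative is an angular derivative. Non-triviality follows by varying
a solution in the direction dual to `Λ`, which makes the density a sum of squares.

For the algebra, the space of functionals is identified with `ChargeParam`: a constant, the constant
`Λ^J`, and the loops along `P_a` and `G_a`; `Λ^H` drops out. The map is injective because there are
enough solutions (`chargeMap_injective`) and onto because complex loops are combinations of real
ones (`range_chargeMap`). Up to a total derivative, the gauge variation of a charge is the charge of
a bracket of parameters (`chargeMap_paramBracket`): the double extension of the abelian space of
loop pairs by the rotation `J`, with a cocycle whose derivative part comes from `∂_φ Λ` and whose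
`ε` part comes from the fixed term `-J` of `a_φ`. Jacobi reduces to rotation invariance of the
alternating cocycle. Uniqueness holds since gauge variations determine the bracket with every
charge, while antisymmetry and the invariance of constants settle the bracket with constants. The
mode brackets are then integrals of exponentials, and the expansion of a charge in modes is
Parseval's identity. -/

namespace Carroll

variable {R : Type*} [CommRing R]

theorem metric_lie (x y z : Carroll R) : metric ⁅x, y⁆ z = metric x ⁅y, z⁆ := by
  simp [metric, bracket_H, bracket_P, bracket_J, bracket_G, eps, Fin.sum_univ_two]
  ring

theorem metric_comm (x y : Carroll R) : metric x y = metric y x := by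
  simp [metric, Fin.sum_univ_two]
  ring

theorem metric_add_left (x y z : Carroll R) : metric (x + y) z = metric x z + metric y z := by
  simp [metric, Fin.sum_univ_two]
  ring

theorem metric_add_right (x y z : Carroll R) : metric x (y + z) = metric x y + metric x z := by
  simp [metric, Fin.sum_univ_two]
  ring

theorem metric_smul_right (c : R) (x y : Carroll R) : metric x (c • y) = c * metric x y := by
  simp [metric, Fin.sum_univ_two]
  ring

theorem metric_neg_right (x y : Carroll R) : metric x (-y) = -metric x y := by
  simp [metric, Fin.sum_univ_two]
  ring

@[simp] theorem sub_coeff (x y : Carroll R) (i : CarrollGen) : (x - y) i = x i - y i := rfl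

@[simp] theorem gen_coeff (X Y : CarrollGen) : (gen X : Carroll R) Y = if Y = X then 1 else 0 := rfl

/-- `ad P₂` sends `J` to `P₁` and `G₁` to `H`, kills the other generators, and both images commute
with `P₂`. Hence the exponential stops at first order. -/
theorem ad_P_one_sq :
    (LieAlgebra.ad ℝ (Carroll ℝ) (gen (.P 1)) : Module.End ℝ (Carroll ℝ)) ^ 2 = 0 := by
  ext x i
  rw [pow_two]
  rcases i with _ | b | _ | b <;> simp [bracket_H, bracket_P, bracket_J, bracket_G, eps]

end Carroll

open Carroll

/-! ### Conjugation by the radial group element. -/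

theorem radialConj_apply (ρ : ℝ) (x : Carroll ℝ) :
    radialConj ρ x = x - ρ • ⁅(gen (.P 1) : Carroll ℝ), x⁆ := by
  have h : ((-ρ) • (LieAlgebra.ad ℝ (Carroll ℝ) (gen (.P 1)) : Module.End ℝ (Carroll ℝ))) ^ 2
      = 0 := by
    rw [smul_pow, ad_P_one_sq, smul_zero]
  rw [radialConj, IsNilpotent.exp_eq_sum h]
  simp [Finset.sum_range_succ, sub_eq_add_neg]

theorem radialConj_H (ρ : ℝ) (x : Carroll ℝ) : radialConj ρ x .H = x .H - ρ * x (.G 0) := by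
  simp [radialConj_apply, bracket_H, eps, Fin.sum_univ_two]

theorem radialConj_P_zero (ρ : ℝ) (x : Carroll ℝ) :
    radialConj ρ x (.P 0) = x (.P 0) - ρ * x .J := by
  simp [radialConj_apply, bracket_P, eps]

theorem radialConj_P_one (ρ : ℝ) (x : Carroll ℝ) : radialConj ρ x (.P 1) = x (.P 1) := by
  simp [radialConj_apply, bracket_P, eps]

theorem radialConj_J (ρ : ℝ) (x : Carroll ℝ) : radialConj ρ x .J = x .J := by
  simp [radialConj_apply, bracket_J]

theorem radialConj_G (ρ : ℝ) (x : Carroll ℝ) (c : Fin 2) : radialConj ρ x (.G c) = x (.G c) := by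
  simp [radialConj_apply, bracket_G]

/-- The exponential of a nilpotent derivation is an automorphism; in this small algebra coordinates
suffice. -/
theorem radialConj_lie (ρ : ℝ) (x y : Carroll ℝ) :
    radialConj ρ ⁅x, y⁆ = ⁅radialConj ρ x, radialConj ρ y⁆ := by
  ext i
  rcases i with _ | b | _ | b
  · simp [radialConj_H, radialConj_P_zero, radialConj_P_one, radialConj_G, bracket_H, bracket_G,
      eps, Fin.sum_univ_two]
    ring
  · fin_cases b
    · simp [radialConj_P_zero, radialConj_P_one, radialConj_J, bracket_P, bracket_J, eps,
        Fin.sum_univ_two]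
    · simp [radialConj_P_zero, radialConj_P_one, radialConj_J, bracket_P, eps, Fin.sum_univ_two]
      ring
  · simp [radialConj_J, bracket_J]
  · simp [radialConj_J, radialConj_G, bracket_G]

theorem radialConj_injective (ρ : ℝ) : Function.Injective (radialConj ρ) := by
  intro x y h
  have hc (i) : radialConj ρ x i = radialConj ρ y i := by rw [h]
  have hJ := hc .J
  have hG (c) := hc (.G c)
  have hH := hc .H
  have hP0 := hc (.P 0)
  have hP1 := hc (.P 1)
  simp only [radialConj_H, radialConj_P_zero, radialConj_P_one, radialConj_J, radialConj_G] at *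
  ext i
  rcases i with _ | b | _ | b
  · rw [hG] at hH; linarith
  · fin_cases b
    · rw [hJ] at hP0; simpa using hP0
    · exact hP1
  · exact hJ
  · exact hG b

/-- This removes `ρ` from the charges. -/
theorem metric_radialConj (ρ : ℝ) (x y : Carroll ℝ) :
    metric (radialConj ρ x) (radialConj ρ y) = metric x y := by
  simp [metric, radialConj_H, radialConj_P_zero, radialConj_P_one, radialConj_J, radialConj_G,
    Fin.sum_univ_two]
  ring

theorem radialConj_gen_H (ρ : ℝ) : radialConj ρ (gen .H) = gen .H := by
  rw [radialConj_apply]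
  ext i
  rcases i with _ | b | _ | b <;> simp [bracket_H, bracket_P, bracket_J, bracket_G]

theorem gen_H_lie (x : Carroll ℝ) : ⁅(gen .H : Carroll ℝ), x⁆ = 0 := by
  ext i
  rcases i with _ | b | _ | b <;> simp [bracket_H, bracket_P, bracket_J, bracket_G]

/-- The correction term is itself a bracket with `P₂`, so a second bracket kills it. This makes the
`ρ`-components of curvature and gauge variation cancel. -/
theorem gen_P_lie_radialConj (ρ : ℝ) (x : Carroll ℝ) :
    ⁅(gen (.P 1) : Carroll ℝ), radialConj ρ x⁆ = ⁅(gen (.P 1) : Carroll ℝ), x⁆ := by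
  ext i
  rcases i with _ | b | _ | b <;>
    simp [bracket_H, bracket_P, bracket_J, bracket_G, radialConj_J, radialConj_G]

/-! ### Calculus for Lie algebra valued functions -/

theorem Carroll.hasDerivAt_metric {f g : ℝ → Carroll ℝ} {f' g' : Carroll ℝ} {s : ℝ}
    (hf : ∀ X, HasDerivAt (fun u => f u X) (f' X) s)
    (hg : ∀ X, HasDerivAt (fun u => g u X) (g' X) s) :
    HasDerivAt (fun u => metric (f u) (g u)) (metric f' (g s) + metric (f s) g') s := by
  have h := (((hf .H).mul (hg .J)).add ((hf .J).mul (hg .H))).neg.add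
    (HasDerivAt.fun_sum (u := Finset.univ) fun (a : Fin 2) _ =>
      ((hf (.P a)).mul (hg (.G a))).add ((hf (.G a)).mul (hg (.P a))))
  refine h.congr_deriv ?_
  simp [metric, Fin.sum_univ_two]
  ring

theorem contDiff_metric {E : Type*} [NormedAddCommGroup E] [NormedSpace ℝ E] {n : WithTop ℕ∞}
    {f g : E → Carroll ℝ} (hf : ∀ X, ContDiff ℝ n fun x => f x X)
    (hg : ∀ X, ContDiff ℝ n fun x => g x X) : ContDiff ℝ n fun x => metric (f x) (g x) := by
  unfold metric
  have := hf .H; have := hf .J; have := hg .H; have := hg .J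
  have := fun a => hf (.P a); have := fun a => hf (.G a)
  have := fun a => hg (.P a); have := fun a => hg (.G a)
  fun_prop

theorem contDiff_lie {E : Type*} [NormedAddCommGroup E] [NormedSpace ℝ E] {n : WithTop ℕ∞}
    {f g : E → Carroll ℝ} (hf : ∀ X, ContDiff ℝ n fun x => f x X)
    (hg : ∀ X, ContDiff ℝ n fun x => g x X) (X : CarrollGen) :
    ContDiff ℝ n fun x => ⁅f x, g x⁆ X := by
  have := hf .J; have := hg .J
  have := fun a => hf (.P a); have := fun a => hf (.G a)
  have := fun a => hg (.P a); have := fun a => hg (.G a)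
  rcases X with _ | b | _ | b
  · simp only [bracket_H]; fun_prop
  · simp only [bracket_P]; fun_prop
  · simp only [bracket_J]; fun_prop
  · simp only [bracket_G]; fun_prop

/-- The divergence theorem on a rectangle whose sides `y = 0` and `y = 2π` cancel. It serves with `x
= ρ` for the Gauss constraint and with `x = t` for conservation. -/
theorem integral2_deriv_of_periodic {f g : ℝ × ℝ → ℝ} (hf : ContDiff ℝ ∞ f) (hg : ContDiff ℝ ∞ g)
    (hper : ∀ x, g (x, 2 * Real.pi) = g (x, 0)) (a b : ℝ) :
    ∫ x in a..b, ∫ y in (0 : ℝ)..(2 * Real.pi),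
        (deriv (fun u => f (u, y)) x + deriv (fun v => g (x, v)) y)
      = (∫ y in (0 : ℝ)..(2 * Real.pi), f (b, y)) - ∫ y in (0 : ℝ)..(2 * Real.pi), f (a, y) := by
  have hf1 (x y : ℝ) : deriv (fun u => f (u, y)) x = fderiv ℝ f (x, y) (1, 0) := by
    have h := ((hf.differentiable (by simp)) (x, y)).hasFDerivAt.comp_hasDerivAt x
      ((hasDerivAt_id x).prodMk (hasDerivAt_const x y))
    exact h.deriv
  have hg1 (x y : ℝ) : deriv (fun v => g (x, v)) y = fderiv ℝ g (x, y) (0, 1) := by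
    have h := ((hg.differentiable (by simp)) (x, y)).hasFDerivAt.comp_hasDerivAt y
      ((hasDerivAt_const y x).prodMk (hasDerivAt_id y))
    exact h.deriv
  simp only [hf1, hg1]
  have hfc : Continuous (fderiv ℝ f) := hf.continuous_fderiv (by simp)
  have hgc : Continuous (fderiv ℝ g) := hg.continuous_fderiv (by simp)
  have h := MeasureTheory.integral2_divergence_prod_of_hasFDerivAt f g _ _ a 0 b (2 * Real.pi)
    hf.continuous.continuousOn hg.continuous.continuousOn
    (fun x _ => (hf.differentiable (by simp) x).hasFDerivAt)
    (fun x _ => (hg.differentiable (by simp) x).hasFDerivAt)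
    (Continuous.continuousOn (by fun_prop) |>.integrableOn_compact
      (isCompact_uIcc.prod isCompact_uIcc))
  rw [h]
  simp [hper]

/-! ### Partial derivatives of bulk fields -/

theorem BulkField.pd_coeff {f : BulkField} (hf : f.SmoothPeriodic) (i : Fin 3) (x : Fin 3 → ℝ)
    (X : CarrollGen) :
    f.pd i x X = fderiv ℝ (fun y => f y X) x (Pi.single i 1) :=
  ((hf.1 X).differentiable (by simp) x).lineDeriv_eq_fderiv

theorem BulkField.contDiff_pd {f : BulkField} (hf : f.SmoothPeriodic) (i : Fin 3) (X : CarrollGen) :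
    ContDiff ℝ ∞ fun x => f.pd i x X := by
  simp only [BulkField.pd_coeff hf]
  exact ((hf.1 X).fderiv_right (m := ∞) (by simp)).clm_apply contDiff_const

theorem BulkField.hasDerivAt_radial {f : BulkField} (hf : f.SmoothPeriodic) (t ρ φ : ℝ)
    (X : CarrollGen) : HasDerivAt (fun u => f ![t, u, φ] X) (f.pd 1 ![t, ρ, φ] X) ρ := by
  have h : HasDerivAt (fun u : ℝ => (![t, u, φ] : Fin 3 → ℝ)) (Pi.single 1 1) ρ := by
    rw [hasDerivAt_pi]
    intro i
    fin_cases i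
    · simpa using hasDerivAt_const ρ t
    · exact hasDerivAt_id ρ
    · simpa using hasDerivAt_const ρ φ
  rw [BulkField.pd_coeff hf]
  exact ((hf.1 X).differentiable (by simp) _).hasFDerivAt.comp_hasDerivAt ρ h

theorem BulkField.hasDerivAt_angular {f : BulkField} (hf : f.SmoothPeriodic) (t ρ φ : ℝ)
    (X : CarrollGen) : HasDerivAt (fun u => f ![t, ρ, u] X) (f.pd 2 ![t, ρ, φ] X) φ := by
  have h : HasDerivAt (fun u : ℝ => (![t, ρ, u] : Fin 3 → ℝ)) (Pi.single 2 1) φ := by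
    rw [hasDerivAt_pi]
    intro i
    fin_cases i
    · simpa using hasDerivAt_const φ t
    · simpa using hasDerivAt_const φ ρ
    · exact hasDerivAt_id φ
  rw [BulkField.pd_coeff hf]
  exact ((hf.1 X).differentiable (by simp) _).hasFDerivAt.comp_hasDerivAt φ h

/-! ### Differentiability of the smeared constraint -/

theorem contDiff_slice (t : ℝ) {s : (Fin 3 → ℝ) → ℝ} (hs : ContDiff ℝ ∞ s) :
    ContDiff ℝ ∞ fun z : ℝ × ℝ => s ![t, z.1, z.2] := by
  refine hs.comp (contDiff_pi.2 fun i => ?_)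
  fin_cases i
  · exact contDiff_const
  · exact contDiff_fst
  · exact contDiff_snd

theorem integral2_add {f g : ℝ → ℝ → ℝ} (hf : Continuous f.uncurry) (hg : Continuous g.uncurry)
    (a b c d : ℝ) :
    ∫ x in a..b, ∫ y in c..d, (f x y + g x y)
      = (∫ x in a..b, ∫ y in c..d, f x y) + ∫ x in a..b, ∫ y in c..d, g x y := by
  rw [← intervalIntegral.integral_add]
  · congr 1
    ext x
    exact intervalIntegral.integral_add
      ((hf.comp (Continuous.prodMk_right x)).intervalIntegrable _ _)
      ((hg.comp (Continuous.prodMk_right x)).intervalIntegrable _ _)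
  · exact (intervalIntegral.continuous_parametric_intervalIntegral_of_continuous' hf c d
      ).intervalIntegrable _ _
  · exact (intervalIntegral.continuous_parametric_intervalIntegral_of_continuous' hg c d
      ).intervalIntegrable _ _

/-- The linearization of the field strength at the connection `A`. -/
noncomputable def linearFieldStrength (A δA : OneForm) (i j : Fin 3) : BulkField :=
  fun x => (δA j).pd i x - (δA i).pd j x + (⁅A i x, δA j x⁆ + ⁅δA i x, A j x⁆)

/-- The curvature is quadratic in the connection, so the expansion is exact and no differentiation
under an integral is needed later. -/
theorem fieldStrength_add_smul {A δA : OneForm} (hA : ∀ i, (A i).SmoothPeriodic)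
    (hδ : ∀ i, (δA i).SmoothPeriodic) (ε : ℝ) (i j : Fin 3) (x : Fin 3 → ℝ) :
    fieldStrength (A + ε • δA) i j x
      = fieldStrength A i j x + (ε • linearFieldStrength A δA i j x
        + ε ^ 2 • ⁅δA i x, δA j x⁆) := by
  have hpd (i j : Fin 3) : ((A + ε • δA) j).pd i x = (A j).pd i x + ε • (δA j).pd i x := by
    ext X
    have h1 := ((hA j).1 X).differentiable (by simp) x
    have h2 := ((hδ j).1 X).differentiable (by simp) x
    have h := (h1.hasFDerivAt.add (h2.hasFDerivAt.const_smul ε)).hasLineDerivAt (Pi.single i 1)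
    simp only [add_coeff, smul_coeff, BulkField.pd_coeff (hA j), BulkField.pd_coeff (hδ j)]
    exact h.lineDeriv
  have hv (i) : (A + ε • δA) i x = A i x + ε • δA i x := rfl
  simp only [fieldStrength, linearFieldStrength, hpd, hv, lie_add, add_lie, lie_smul, smul_lie]
  module

/-- Pointwise integration by parts: `Λᵢ` stands for `∂ᵢΛ` and `δⱼᵢ` for `∂ᵢ δAⱼ`. The brackets with
`A` may be inserted because they cancel by invariance of the metric. -/
theorem Carroll.metric_leibniz {R : Type*} [CommRing R]
    (Λ Λ₁ Λ₂ δ₁ δ₂ δ₁₂ δ₂₁ A₁ A₂ : Carroll R) :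
    metric Λ₁ δ₂ + metric Λ δ₂₁ + -(metric Λ₂ δ₁ + metric Λ δ₁₂)
      = metric Λ (δ₂₁ - δ₁₂ + (⁅A₁, δ₂⁆ + ⁅δ₁, A₂⁆))
        + (metric (Λ₁ + ⁅A₁, Λ⁆) δ₂ + -1 * metric (Λ₂ + ⁅A₂, Λ⁆) δ₁) := by
  have h1 : metric ⁅A₁, Λ⁆ δ₂ = -metric Λ ⁅A₁, δ₂⁆ := by
    rw [← lie_skew, metric_comm, metric_neg_right, metric_comm, metric_lie]
  have h2 : metric ⁅A₂, Λ⁆ δ₁ = metric Λ ⁅δ₁, A₂⁆ := by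
    rw [metric_comm, ← metric_lie, metric_comm]
  rw [sub_eq_add_neg, metric_add_right, metric_add_right, metric_add_right, metric_neg_right,
    metric_add_left, metric_add_left, h1, h2]
  ring

theorem hasDerivAt_smearedConstraint (k : ℝ) {A δA : OneForm} {Λ : BulkField}
    (hA : ∀ i, (A i).SmoothPeriodic) (hδ : ∀ i, (δA i).SmoothPeriodic) (hΛ : Λ.SmoothPeriodic)
    (t r R : ℝ) :
    HasDerivAt (fun ε : ℝ => smearedConstraint k t r R Λ (A + ε • δA))
      (symplecticForm k t r R (gaugeVariation A Λ) δA
        - (chargeVariation k t R Λ δA - chargeVariation k t r Λ δA)) 0 := by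
  have cont {f g : BulkField} (hf : ∀ X, ContDiff ℝ ∞ fun x => f x X)
      (hg : ∀ X, ContDiff ℝ ∞ fun x => g x X) :
      Continuous (fun ρ φ : ℝ => metric (f ![t, ρ, φ]) (g ![t, ρ, φ])).uncurry :=
    (contDiff_slice t (contDiff_metric hf hg)).continuous
  have hlie (i j) (X) : ContDiff ℝ ∞ fun x => ⁅δA i x, δA j x⁆ X :=
    contDiff_lie (hδ i).1 (hδ j).1 X
  have hF (X) : ContDiff ℝ ∞ fun x => fieldStrength A 1 2 x X :=
    ((BulkField.contDiff_pd (hA 2) 1 X).sub (BulkField.contDiff_pd (hA 1) 2 X)).add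
      (contDiff_lie (hA 1).1 (hA 2).1 X)
  have hL (X) : ContDiff ℝ ∞ fun x => linearFieldStrength A δA 1 2 x X :=
    ((BulkField.contDiff_pd (hδ 2) 1 X).sub (BulkField.contDiff_pd (hδ 1) 2 X)).add
      ((contDiff_lie (hA 1).1 (hδ 2).1 X).add (contDiff_lie (hδ 1).1 (hA 2).1 X))
  have hG (i) (X) : ContDiff ℝ ∞ fun x => gaugeVariation A Λ i x X :=
    (BulkField.contDiff_pd hΛ i X).add (contDiff_lie (hA i).1 hΛ.1 X)
  set I : (ℝ → ℝ → ℝ) → ℝ := fun f =>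
    ∫ ρ in r..R, ∫ φ in (0 : ℝ)..(2 * Real.pi), f ρ φ with hI
  have hIadd {f g : ℝ → ℝ → ℝ} (hf : Continuous f.uncurry) (hg : Continuous g.uncurry) :
      I (fun ρ φ => f ρ φ + g ρ φ) = I f + I g := integral2_add hf hg _ _ _ _
  have hImul (c : ℝ) (f : ℝ → ℝ → ℝ) : I (fun ρ φ => c * f ρ φ) = c * I f := by
    simp only [hI, intervalIntegral.integral_const_mul]
  -- A polynomial in `ε`; the derivative at `0` is its linear coefficient.
  have hquad (ε : ℝ) : smearedConstraint k t r R Λ (A + ε • δA) = -(k / (2 * Real.pi)) *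
      (I (fun ρ φ => metric (Λ ![t, ρ, φ]) (fieldStrength A 1 2 ![t, ρ, φ]))
      + (ε * I (fun ρ φ => metric (Λ ![t, ρ, φ]) (linearFieldStrength A δA 1 2 ![t, ρ, φ]))
      + ε ^ 2 * I (fun ρ φ => metric (Λ ![t, ρ, φ]) ⁅δA 1 ![t, ρ, φ], δA 2 ![t, ρ, φ]⁆))) := by
    rw [← hImul, ← hImul, ← hIadd, ← hIadd]
    · simp only [smearedConstraint, fieldStrength_add_smul hA hδ, metric_add_right,
        metric_smul_right, hI]
    · exact cont hΛ.1 hF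
    · exact (continuous_const.mul (cont hΛ.1 hL)).add
        (continuous_const.mul (cont hΛ.1 (hlie 1 2)))
    · exact continuous_const.mul (cont hΛ.1 hL)
    · exact continuous_const.mul (cont hΛ.1 (hlie 1 2))
  have hderiv (a b c : ℝ) : HasDerivAt (fun ε : ℝ => a + (ε * b + ε ^ 2 * c)) b 0 := by
    have h := (((hasDerivAt_id (0 : ℝ)).mul_const b).add
      (((hasDerivAt_id (0 : ℝ)).pow 2).mul_const c)).const_add a
    simpa using h
  rw [funext hquad]
  refine ((hderiv _ _ _).const_mul _).congr_deriv ?_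
  -- The vector field `(⟨Λ, δA_φ⟩, -⟨Λ, δA_ρ⟩)` has the exterior derivative of `⟨Λ, δA⟩` as its
  -- divergence, and its flux through the circles is the charge variation.
  have hdiv := integral2_deriv_of_periodic
    (f := fun z => metric (Λ ![t, z.1, z.2]) (δA 2 ![t, z.1, z.2]))
    (g := fun z => -metric (Λ ![t, z.1, z.2]) (δA 1 ![t, z.1, z.2]))
    (contDiff_slice t (contDiff_metric hΛ.1 (hδ 2).1))
    (contDiff_slice t (contDiff_metric hΛ.1 (hδ 1).1)).neg
    (fun ρ => by
      have h1 := hΛ.2 t ρ 0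
      have h2 := (hδ 1).2 t ρ 0
      rw [zero_add] at h1 h2
      simp only [h1, h2]) r R
  have hint (ρ φ : ℝ) :
      deriv (fun u => metric (Λ ![t, u, φ]) (δA 2 ![t, u, φ])) ρ
        + deriv (fun v => -metric (Λ ![t, ρ, v]) (δA 1 ![t, ρ, v])) φ
      = metric (Λ ![t, ρ, φ]) (linearFieldStrength A δA 1 2 ![t, ρ, φ])
        + (metric (gaugeVariation A Λ 1 ![t, ρ, φ]) (δA 2 ![t, ρ, φ])
          + -1 * metric (gaugeVariation A Λ 2 ![t, ρ, φ]) (δA 1 ![t, ρ, φ])) := by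
    have h1 := (hasDerivAt_metric (BulkField.hasDerivAt_radial hΛ t ρ φ)
      (BulkField.hasDerivAt_radial (hδ 2) t ρ φ)).deriv
    have h2 := (hasDerivAt_metric (BulkField.hasDerivAt_angular hΛ t ρ φ)
      (BulkField.hasDerivAt_angular (hδ 1) t ρ φ)).fun_neg.deriv
    rw [h1, h2]
    exact metric_leibniz _ _ _ _ _ _ _ _ _
  simp only [hint] at hdiv
  change I (fun ρ φ => _ + (_ + -1 * _)) = _ at hdiv
  have hGc : Continuous (fun ρ φ : ℝ =>
      metric (gaugeVariation A Λ 1 ![t, ρ, φ]) (δA 2 ![t, ρ, φ])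
        + -1 * metric (gaugeVariation A Λ 2 ![t, ρ, φ]) (δA 1 ![t, ρ, φ])).uncurry :=
    (cont (hG 1) (hδ 2).1).add (continuous_const.mul (cont (hG 2) (hδ 1).1))
  rw [hIadd (cont hΛ.1 hL) hGc] at hdiv
  have hsymp : symplecticForm k t r R (gaugeVariation A Λ) δA = k / (2 * Real.pi) *
      I (fun ρ φ => metric (gaugeVariation A Λ 1 ![t, ρ, φ]) (δA 2 ![t, ρ, φ])
          + -1 * metric (gaugeVariation A Λ 2 ![t, ρ, φ]) (δA 1 ![t, ρ, φ])) := by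
    simp only [symplecticForm, hI, neg_one_mul, sub_eq_add_neg]
  rw [hsymp, chargeVariation, chargeVariation, ← mul_sub, ← hdiv]
  ring

/-! ### Fields of the boundary coordinates -/

/-- The time derivative. -/
noncomputable def BoundaryField.dt (f : BoundaryField) : BoundaryField :=
  fun t φ => ⟨fun X => deriv (fun u => f u φ X) t⟩

/-- The angular derivative. -/
noncomputable def BoundaryField.dφ (f : BoundaryField) : BoundaryField :=
  fun t φ => ⟨fun X => deriv (fun u => f t u X) φ⟩

theorem BoundaryField.hasDerivAt_time {f : BoundaryField} (hf : f.SmoothPeriodic) (t φ : ℝ)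
    (X : CarrollGen) : HasDerivAt (fun u => f u φ X) (f.dt t φ X) t := by
  have h : Differentiable ℝ fun u => f u φ X :=
    ((hf.1 X).comp (contDiff_id.prodMk contDiff_const)).differentiable (by simp)
  exact (h t).hasDerivAt

theorem BoundaryField.contDiff_angular {f : BoundaryField} (hf : f.SmoothPeriodic) (t : ℝ)
    (X : CarrollGen) : ContDiff ℝ ∞ fun u => f t u X :=
  (hf.1 X).comp (contDiff_const.prodMk contDiff_id)

theorem BoundaryField.hasDerivAt_angular {f : BoundaryField} (hf : f.SmoothPeriodic) (t φ : ℝ)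
    (X : CarrollGen) : HasDerivAt (fun u => f t u X) (f.dφ t φ X) φ :=
  ((contDiff_angular hf t X).differentiable (by simp) φ).hasDerivAt

theorem contDiff_deriv_snd {f : ℝ → ℝ → ℝ} (hf : ContDiff ℝ ∞ fun z : ℝ × ℝ => f z.1 z.2) :
    ContDiff ℝ ∞ fun z : ℝ × ℝ => deriv (f z.1) z.2 := by
  have h (z : ℝ × ℝ) :
      deriv (f z.1) z.2 = fderiv ℝ (fun z : ℝ × ℝ => f z.1 z.2) z (0, 1) :=
    (HasFDerivAt.comp_hasDerivAt (f := fun u : ℝ => (z.1, u)) z.2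
      (hf.differentiable (by simp) z).hasFDerivAt
      ((hasDerivAt_const z.2 z.1).prodMk (hasDerivAt_id z.2))).deriv
  simp only [h]
  exact (hf.fderiv_right (m := ∞) (by simp)).clm_apply contDiff_const

theorem BoundaryField.SmoothPeriodic.dφ {f : BoundaryField} (hf : f.SmoothPeriodic) :
    f.dφ.SmoothPeriodic := by
  refine ⟨fun X => contDiff_deriv_snd (f := fun t φ => f t φ X) (hf.1 X), fun t φ => ?_⟩
  ext X
  have h : (fun u => f t (u + 2 * Real.pi) X) = fun u => f t u X :=
    funext fun u => by rw [hf.2]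
  change deriv _ _ = deriv _ _
  conv_rhs => rw [← h]
  exact (deriv_comp_add_const (f := fun u => f t u X) _ _).symm

theorem BoundaryField.SmoothPeriodic.add {f g : BoundaryField} (hf : f.SmoothPeriodic)
    (hg : g.SmoothPeriodic) : (f + g).SmoothPeriodic :=
  ⟨fun X => (hf.1 X).add (hg.1 X), fun t φ => congrArg₂ (· + ·) (hf.2 t φ) (hg.2 t φ)⟩

theorem BoundaryField.SmoothPeriodic.smul {f : BoundaryField} (hf : f.SmoothPeriodic) (c : ℝ) :
    (c • f).SmoothPeriodic :=
  ⟨fun X => contDiff_const.mul (hf.1 X), fun t φ => congrArg (c • ·) (hf.2 t φ)⟩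

theorem BoundaryField.SmoothPeriodic.lie {f g : BoundaryField} (hf : f.SmoothPeriodic)
    (hg : g.SmoothPeriodic) : BoundaryField.SmoothPeriodic fun t φ => ⁅f t φ, g t φ⁆ :=
  ⟨contDiff_lie hf.1 hg.1, fun t φ => by simp only [hf.2 t φ, hg.2 t φ]⟩

theorem BoundaryField.SmoothPeriodic.const (x : Carroll ℝ) :
    BoundaryField.SmoothPeriodic fun _ _ => x :=
  ⟨fun _ => contDiff_const, fun _ _ => rfl⟩

theorem boundaryVariation_eq (Λ a : BoundaryField) (t φ : ℝ) :
    boundaryVariation Λ a t φ = Λ.dφ t φ + ⁅a t φ, Λ t φ⁆ := rfl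

theorem BoundaryField.SmoothPeriodic.boundaryVariation {Λ a : BoundaryField}
    (hΛ : Λ.SmoothPeriodic) (ha : a.SmoothPeriodic) : (boundaryVariation Λ a).SmoothPeriodic :=
  hΛ.dφ.add (ha.lie hΛ)

/-! ### Dressed fields -/

theorem dressed_coeff (f : BoundaryField) (x : Fin 3 → ℝ) (X : CarrollGen) :
    dressed f x X = f (x 0) (x 2) X - x 1 * ⁅(gen (.P 1) : Carroll ℝ), f (x 0) (x 2)⁆ X := by
  simp [dressed, radialConj_apply]

theorem dressed_pd_time {f : BoundaryField} (hf : f.SmoothPeriodic) :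
    (dressed f).pd 0 = dressed f.dt := by
  ext x X
  have hd (Y) : HasDerivAt (fun s => f (x 0 + s) (x 2) Y) (f.dt (x 0) (x 2) Y) 0 :=
    HasDerivAt.comp_const_add (f := fun u => f u (x 2) Y) (x 0) 0
      (by simpa using BoundaryField.hasDerivAt_time hf (x 0) (x 2) Y)
  simp only [BulkField.pd, lineDeriv, Pi.add_apply, Pi.smul_apply, Pi.single_apply, dressed]
  have hP0 := ((hd (.P 0)).fun_sub ((hd .J).const_mul (x 1))).deriv
  have hH := ((hd .H).fun_sub ((hd (.G 0)).const_mul (x 1))).deriv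
  rcases X with _ | c | _ | c
  · simpa [radialConj_H, BoundaryField.dt] using hH
  · fin_cases c
    · simpa [radialConj_P_zero, BoundaryField.dt] using hP0
    · simpa [radialConj_P_one, BoundaryField.dt] using (hd (.P 1)).deriv
  · simpa [radialConj_J, BoundaryField.dt] using (hd .J).deriv
  · simpa [radialConj_G, BoundaryField.dt] using (hd (.G c)).deriv

theorem dressed_pd_angular {f : BoundaryField} (hf : f.SmoothPeriodic) :
    (dressed f).pd 2 = dressed f.dφ := by
  ext x X
  have hd (Y) : HasDerivAt (fun s => f (x 0) (x 2 + s) Y) (f.dφ (x 0) (x 2) Y) 0 :=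
    HasDerivAt.comp_const_add (f := fun u => f (x 0) u Y) (x 2) 0
      (by simpa using BoundaryField.hasDerivAt_angular hf (x 0) (x 2) Y)
  simp only [BulkField.pd, lineDeriv, Pi.add_apply, Pi.smul_apply, Pi.single_apply, dressed]
  have hP0 := ((hd (.P 0)).fun_sub ((hd .J).const_mul (x 1))).deriv
  have hH := ((hd .H).fun_sub ((hd (.G 0)).const_mul (x 1))).deriv
  rcases X with _ | c | _ | c
  · simpa [radialConj_H, BoundaryField.dφ] using hH
  · fin_cases c
    · simpa [radialConj_P_zero, BoundaryField.dφ] using hP0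
    · simpa [radialConj_P_one, BoundaryField.dφ] using (hd (.P 1)).deriv
  · simpa [radialConj_J, BoundaryField.dφ] using (hd .J).deriv
  · simpa [radialConj_G, BoundaryField.dφ] using (hd (.G c)).deriv

/-- Along `ρ` the dressed field is affine, so no regularity of `f` is required and the slope is
constant. -/
theorem dressed_pd_radial (f : BoundaryField) (x : Fin 3 → ℝ) :
    (dressed f).pd 1 x = -⁅(gen (.P 1) : Carroll ℝ), f (x 0) (x 2)⁆ := by
  ext X
  simp only [BulkField.pd, lineDeriv, dressed_coeff, Pi.add_apply, Pi.smul_apply, Pi.single_apply]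
  have h := (((((hasDerivAt_id (0 : ℝ)).const_add (x 1)).mul_const
    (⁅(gen (.P 1) : Carroll ℝ), f (x 0) (x 2)⁆ X)).const_sub (f (x 0) (x 2) X))).deriv
  simpa only [mul_comm, Fin.isValue, id, smul_eq_mul, Pi.single_eq_same, if_true, zero_ne_one,
    Fin.reduceEq, if_false, mul_zero, mul_one, add_zero, one_mul, zero_mul, neg_coeff] using h

theorem pd_const (i : Fin 3) (y : Carroll ℝ) (x : Fin 3 → ℝ) :
    BulkField.pd i (fun _ => y) x = 0 := by
  ext X
  simp [BulkField.pd, lineDeriv]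

/-! ### Field strength and gauge variations of the allowed connections -/

theorem smoothPeriodic_gen_H {μ : ℝ → ℝ → ℝ} (hμ : ContDiff ℝ ∞ (fun z : ℝ × ℝ => μ z.1 z.2))
    (hμper : ∀ t φ : ℝ, μ t (φ + 2 * Real.pi) = μ t φ) :
    BoundaryField.SmoothPeriodic fun t φ => μ t φ • (gen .H : Carroll ℝ) :=
  ⟨fun _ => hμ.mul contDiff_const, fun t φ => by simp only [hμper]⟩

/-- In `dt` the bracket vanishes because `μ H` is central; in `dρ` the slope of the conjugation
cancels the bracket with `P₂`; in `dφ` the conjugation passes through the bracket. -/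
theorem gaugeVariation_connection (μ : ℝ → ℝ → ℝ) {Λ : BoundaryField} (hΛ : Λ.SmoothPeriodic)
    (a : BoundaryField) : gaugeVariation (connection μ a) (dressed Λ)
      = ![dressed Λ.dt, 0, dressed (boundaryVariation Λ a)] := by
  funext i x
  fin_cases i
  · simp [gaugeVariation, connection, dressed_pd_time hΛ, dressed, radialConj_gen_H, gen_H_lie]
  · simp [gaugeVariation, connection, dressed_pd_radial, dressed, gen_P_lie_radialConj,
      -lie_skew]
  · simp [gaugeVariation, connection, dressed_pd_angular hΛ, dressed, boundaryVariation_eq,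
      radialConj_lie]

theorem fieldStrength_swap (A : OneForm) (i j : Fin 3) (x : Fin 3 → ℝ) :
    fieldStrength A j i x = -fieldStrength A i j x := by
  simp only [fieldStrength]
  rw [← lie_skew]
  abel

theorem fieldStrength_connection_time_angular {μ : ℝ → ℝ → ℝ}
    (hμ : ContDiff ℝ ∞ (fun z : ℝ × ℝ => μ z.1 z.2))
    (hμper : ∀ t φ : ℝ, μ t (φ + 2 * Real.pi) = μ t φ) {a : BoundaryField}
    (ha : a.SmoothPeriodic) (x : Fin 3 → ℝ) :
    fieldStrength (connection μ a) 0 2 x =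
      radialConj (x 1) (a.dt (x 0) (x 2) - deriv (fun u => μ (x 0) u) (x 2) • gen .H) := by
  have hd : BoundaryField.dφ (fun t φ => μ t φ • (gen .H : Carroll ℝ)) (x 0) (x 2)
      = deriv (fun u => μ (x 0) u) (x 2) • gen .H := by
    ext X
    have hc : ContDiff ℝ ∞ fun u => μ (x 0) u := hμ.comp (contDiff_const.prodMk contDiff_id)
    exact ((hc.differentiable (by simp) (x 2)).hasDerivAt.mul_const _).deriv
  simp [fieldStrength, connection, dressed_pd_time ha,
    dressed_pd_angular (smoothPeriodic_gen_H hμ hμper), dressed, hd, radialConj_gen_H, gen_H_lie]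

theorem fieldStrength_connection_time_radial (μ : ℝ → ℝ → ℝ) (a : BoundaryField)
    (x : Fin 3 → ℝ) : fieldStrength (connection μ a) 0 1 x = 0 := by
  have h : ⁅(gen (.P 1) : Carroll ℝ), (gen .H : Carroll ℝ)⁆ = 0 := by
    rw [← lie_skew, gen_H_lie, neg_zero]
  simp [fieldStrength, connection, dressed_pd_radial, dressed, radialConj_gen_H, pd_const,
    gen_H_lie, h]

theorem fieldStrength_connection_radial_angular (μ : ℝ → ℝ → ℝ) (a : BoundaryField)
    (x : Fin 3 → ℝ) : fieldStrength (connection μ a) 1 2 x = 0 := by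
  simp [fieldStrength, connection, dressed_pd_radial, pd_const, dressed, gen_P_lie_radialConj,
    -lie_skew]

theorem fieldStrength_self (A : OneForm) (i : Fin 3) (x : Fin 3 → ℝ) :
    fieldStrength A i i x = 0 := by
  simp [fieldStrength]

section

variable {μ : ℝ → ℝ → ℝ} (hμ : ContDiff ℝ ∞ (fun z : ℝ × ℝ => μ z.1 z.2))
  (hμper : ∀ t φ : ℝ, μ t (φ + 2 * Real.pi) = μ t φ)

include hμ hμper

/-- Only `F_tφ` carries information, and the conjugation in front of it is injective. -/
theorem onShell_iff_dt (a : BoundaryField) : OnShell μ a ↔ IsState a ∧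
    ∀ t φ : ℝ, a.dt t φ = deriv (fun u => μ t u) φ • gen .H := by
  refine and_congr_right fun ha => ⟨fun h t φ => ?_, fun h => ?_⟩
  · have h2 := h 0 2 ![t, 0, φ]
    rw [fieldStrength_connection_time_angular hμ hμper ha.1] at h2
    exact sub_eq_zero.1 (radialConj_injective _ (h2.trans (map_zero _).symm))
  · have h02 (x) : fieldStrength (connection μ a) 0 2 x = 0 := by
      rw [fieldStrength_connection_time_angular hμ hμper ha.1, h, sub_self, map_zero]
    have h01 := fieldStrength_connection_time_radial μ a
    have h12 := fieldStrength_connection_radial_angular μ a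
    intro i j x
    fin_cases i <;> fin_cases j
    · exact fieldStrength_self _ _ _
    · exact h01 x
    · exact h02 x
    · exact (fieldStrength_swap _ _ _ _).trans (neg_eq_zero.2 (h01 x))
    · exact fieldStrength_self _ _ _
    · exact h12 x
    · exact (fieldStrength_swap _ _ _ _).trans (neg_eq_zero.2 (h02 x))
    · exact (fieldStrength_swap _ _ _ _).trans (neg_eq_zero.2 (h12 x))
    · exact fieldStrength_self _ _ _

theorem onShell_iff (a : BoundaryField) : OnShell μ a ↔ IsState a ∧ ∀ t φ : ℝ,
      (∀ c, deriv (fun u => a u φ (.P c)) t = 0 ∧ deriv (fun u => a u φ (.G c)) t = 0) ∧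
        deriv (fun u => a u φ .H) t = deriv (fun u => μ t u) φ := by
  rw [onShell_iff_dt hμ hμper]
  refine and_congr_right fun ha => forall₂_congr fun t φ => ⟨fun h => ?_, fun h => ?_⟩
  · have hc (X) : deriv (fun u => a u φ X) t = (deriv (fun u => μ t u) φ • gen .H : Carroll ℝ) X :=
      congrArg (fun y : Carroll ℝ => y X) h
    exact ⟨fun c => ⟨by simp [hc], by simp [hc]⟩, by simp [hc]⟩
  · ext X
    rcases X with _ | c | _ | c
    · simp [BoundaryField.dt, h.2]
    · simp [BoundaryField.dt, h.1 c]
    · simp [BoundaryField.dt, ha.2]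
    · simp [BoundaryField.dt, h.1 c]

end

/-! ### Gauge parameters preserving the boundary conditions. -/

theorem isState_const : IsState fun _ _ => -gen .J :=
  ⟨.const _, fun _ _ => by simp⟩

theorem IsState.isVariation_boundaryVariation {Λ a : BoundaryField} (hΛ : Λ.SmoothPeriodic)
    (hJ : ∀ t φ φ' : ℝ, Λ t φ .J = Λ t φ' .J) (ha : IsState a) :
    IsVariation (boundaryVariation Λ a) := by
  refine ⟨hΛ.boundaryVariation ha.1, fun t φ => ?_⟩
  simp [boundaryVariation, bracket_J, fun u => hJ t u 0]

theorem dressed_injective : Function.Injective dressed := by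
  intro f g h
  funext t φ
  exact radialConj_injective 0 (congrFun h ![t, 0, φ])

theorem BoundaryField.dt_eq_zero_iff {f : BoundaryField} (hf : f.SmoothPeriodic) :
    f.dt = 0 ↔ ∀ t t' φ : ℝ, f t φ = f t' φ := by
  refine ⟨fun h t t' φ => ?_, fun h => ?_⟩
  · ext X
    refine is_const_of_deriv_eq_zero
      (fun s => (BoundaryField.hasDerivAt_time hf s φ X).differentiableAt) (fun s => ?_) t t'
    exact congrArg (fun g : BoundaryField => g s φ X) h
  · funext t φ
    ext X
    simp [BoundaryField.dt, fun u => h u 0 φ]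

/-- Brackets have no `J`-component, so the obstructions `∂_t Λ` and `∂_φ Λ^J` do not involve the
state. -/
theorem admissible_iff (μ : ℝ → ℝ → ℝ) (Λ : BoundaryField) : Admissible μ Λ ↔ Λ.SmoothPeriodic ∧
    (∀ t t' φ : ℝ, Λ t φ = Λ t' φ) ∧ ∀ t φ φ' : ℝ, Λ t φ .J = Λ t φ' .J := by
  refine and_congr_right fun hΛ => ⟨fun h => ?_, fun ⟨ht, hJ⟩ a ha => ?_⟩
  -- One test state suffices, the obstructions being the same for all.
  · obtain ⟨δ, hδ, h⟩ := h _ isState_const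
    rw [gaugeVariation_connection μ hΛ] at h
    have h0 : dressed Λ.dt = 0 := congrFun h 0
    have h2 : dressed (boundaryVariation Λ _) = dressed δ := congrFun h 2
    refine ⟨(BoundaryField.dt_eq_zero_iff hΛ).1 (dressed_injective (h0.trans ?_)),
      fun t φ φ' => is_const_of_deriv_eq_zero
        (fun s => (BoundaryField.hasDerivAt_angular hΛ t s .J).differentiableAt) (fun s => ?_) φ φ'⟩
    · funext x
      exact (map_zero (radialConj (x 1))).symm
    · have hδJ := hδ.2 t s
      rw [← dressed_injective h2] at hδJ
      simpa [boundaryVariation, bracket_J] using hδJ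
  · refine ⟨_, ha.isVariation_boundaryVariation hΛ hJ, ?_⟩
    rw [gaugeVariation_connection μ hΛ, (BoundaryField.dt_eq_zero_iff hΛ).2 ht]
    have h0 : dressed 0 = 0 := funext fun x => map_zero (radialConj (x 1))
    rw [h0, connectionVariation]

theorem Admissible.gaugeVariation_eq {μ : ℝ → ℝ → ℝ} {Λ : BoundaryField} (hΛ : Admissible μ Λ)
    (a : BoundaryField) : gaugeVariation (connection μ a) (dressed Λ)
      = connectionVariation (boundaryVariation Λ a) := by
  have h0 : dressed 0 = 0 := funext fun x => map_zero (radialConj (x 1))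
  rw [gaugeVariation_connection μ hΛ.1,
    (BoundaryField.dt_eq_zero_iff hΛ.1).2 ((admissible_iff μ Λ).1 hΛ).2.1, h0, connectionVariation]

/-! ### Existence of solutions -/

/-- The integral is the value at `0` of the convolution of the indicator of `(0, 1]` with `y ↦ ψ y *
g p (-y)`, and such convolutions are smooth in parameters. -/
theorem contDiff_integral_param {E : Type*} [NormedAddCommGroup E] [NormedSpace ℝ E]
    {g : E → ℝ → ℝ} (hg : ContDiff ℝ ∞ fun q : E × ℝ => g q.1 q.2) :
    ContDiff ℝ ∞ fun p => ∫ s in (0 : ℝ)..1, g p s := by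
  -- The cutoff equals `1` at every `-s` with `s ∈ (0, 1]`, so it leaves the integral unchanged;
  -- outer radius `2` gives compact support.
  let ψ : ContDiffBump (0 : ℝ) := ⟨1, 2, one_pos, one_lt_two⟩
  have h := MeasureTheory.contDiffOn_convolution_right_with_param_comp
    (μ := MeasureTheory.volume) (n := ⊤)
    (𝕜 := ℝ) (ContinuousLinearMap.mul ℝ ℝ) (s := (Set.univ : Set E)) (v := fun _ => (0 : ℝ))
    (f := (Set.Ioc (0 : ℝ) 1).indicator 1) (g := fun p y => ψ y * g p (-y))
    (k := Metric.closedBall 0 2) contDiffOn_const isOpen_univ (isCompact_closedBall 0 2)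
    (fun p x _ hx => by
      rw [ψ.zero_of_le_dist, zero_mul]
      simpa using (not_le.1 fun h => hx (Metric.mem_closedBall.2 h)).le)
    ((MeasureTheory.locallyIntegrable_const (1 : ℝ)).indicator measurableSet_Ioc)
    (((ψ.contDiff.comp contDiff_snd).mul
      (hg.comp (contDiff_fst.prodMk contDiff_snd.neg))).contDiffOn)
  rw [contDiffOn_univ] at h
  refine (congrArg (ContDiff ℝ ∞) (funext fun p => ?_)).mp h
  rw [intervalIntegral.integral_of_le zero_le_one,
    ← MeasureTheory.integral_indicator measurableSet_Ioc]
  refine MeasureTheory.integral_congr_ae (Eventually.of_forall fun s => ?_)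
  by_cases hs : s ∈ Set.Ioc (0 : ℝ) 1
  · have h1 : ψ (-s) = 1 := ψ.one_of_mem_closedBall (by
      simpa [abs_le] using ⟨by linarith [hs.1], hs.2⟩)
    simp [hs, h1]
  · simp [hs]

theorem contDiff_primitive {m : ℝ → ℝ → ℝ} (hm : ContDiff ℝ ∞ fun z : ℝ × ℝ => m z.1 z.2) :
    ContDiff ℝ ∞ fun z : ℝ × ℝ => ∫ s in (0 : ℝ)..z.1, m s z.2 := by
  -- Rescaling the variable turns the moving endpoint into a parameter of the integrand.
  have h : ContDiff ℝ ∞ fun z : ℝ × ℝ => z.1 * ∫ s in (0 : ℝ)..1, m (z.1 * s) z.2 :=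
    contDiff_fst.mul (contDiff_integral_param (g := fun (z : ℝ × ℝ) s => m (z.1 * s) z.2)
      (hm.comp (((contDiff_fst.comp contDiff_fst).mul contDiff_snd).prodMk
        (contDiff_snd.comp contDiff_fst))))
  refine (congrArg (ContDiff ℝ ∞) (funext fun z => ?_)).mp h
  simpa using (intervalIntegral.mul_integral_comp_mul_left (f := fun s => m s z.2) (a := 0)
    (b := 1) z.1)

theorem deriv_periodic {F : Type*} [NormedAddCommGroup F] [NormedSpace ℝ F] {f : ℝ → F} {c : ℝ}
    (hf : ∀ x, f (x + c) = f x) (x : ℝ) :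
    deriv f (x + c) = deriv f x := by
  conv_rhs => rw [← funext hf]
  exact (deriv_comp_add_const (f := f) _ _).symm

section

variable {μ : ℝ → ℝ → ℝ} (hμ : ContDiff ℝ ∞ (fun z : ℝ × ℝ => μ z.1 z.2))
  (hμper : ∀ t φ : ℝ, μ t (φ + 2 * Real.pi) = μ t φ)

include hμ hμper

/-- Take `-J + h H` with `h` the time primitive of `∂_φ μ`. Without a solution, functionals on the
solution space would say nothing about parameters. -/
theorem exists_onShell : ∃ a, OnShell μ a := by
  have hm := contDiff_deriv_snd hμ
  have hs : BoundaryField.SmoothPeriodic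
      fun t φ => (∫ s in (0 : ℝ)..t, deriv (μ s) φ) • (gen .H : Carroll ℝ) :=
    smoothPeriodic_gen_H (μ := fun t φ => ∫ s in (0 : ℝ)..t, deriv (μ s) φ) (contDiff_primitive hm)
      fun t φ => by simp only [deriv_periodic (hμper _)]
  refine ⟨_, (onShell_iff hμ hμper _).2 ⟨⟨isState_const.1.add hs, fun t φ => by simp⟩,
    fun t φ => ⟨fun c => by simp, ?_⟩⟩⟩
  have hc : Continuous fun s => deriv (μ s) φ :=
    hm.continuous.comp (Continuous.prodMk_left φ)
  simpa using hc.deriv_integral _ 0 t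

/-- The field equations are affine; this supplies all test solutions used to separate charges. -/
theorem OnShell.add_of_dt_eq_zero {a δ : BoundaryField} (ha : OnShell μ a) (hδ : IsVariation δ)
    (ht : ∀ t t' φ : ℝ, δ t φ = δ t' φ) : OnShell μ (a + δ) := by
  rw [onShell_iff_dt hμ hμper] at ha ⊢
  refine ⟨⟨ha.1.1.add hδ.1, fun t φ => by simp [ha.1.2, hδ.2]⟩, fun t φ => ?_⟩
  rw [← ha.2]
  ext X
  have h0 := congrArg (fun g : BoundaryField => g t φ X) ((BoundaryField.dt_eq_zero_iff hδ.1).2 ht)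
  have h := ((BoundaryField.hasDerivAt_time ha.1.1 t φ X).add
    (BoundaryField.hasDerivAt_time hδ.1 t φ X)).deriv
  refine h.trans ?_
  simpa using h0

theorem OnShell.time_independent {a : BoundaryField} (ha : OnShell μ a) {X : CarrollGen}
    (hX : X ≠ .H) (t t' φ : ℝ) : a t φ X = a t' φ X := by
  rw [onShell_iff_dt hμ hμper] at ha
  refine is_const_of_deriv_eq_zero (f := fun s => a s φ X)
    (fun s => (BoundaryField.hasDerivAt_time ha.1.1 s φ X).differentiableAt) (fun s => ?_) t t'
  simpa [hX, BoundaryField.dt] using congrArg (fun y : Carroll ℝ => y X) (ha.2 s φ)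

theorem OnShell.add_smul_boundaryVariation {Λ a : BoundaryField} (hΛ : Admissible μ Λ)
    (ha : OnShell μ a) (ε : ℝ) : OnShell μ (a + ε • boundaryVariation Λ a) := by
  obtain ⟨hs, ht, hJ⟩ := (admissible_iff μ Λ).1 hΛ
  have hv := ha.1.isVariation_boundaryVariation hs hJ
  refine ha.add_of_dt_eq_zero hμ hμper ⟨hv.1.smul ε, fun t φ => ?_⟩ fun t t' φ => ?_
  · simp [hv.2]
  · have h : Λ t = Λ t' := funext fun φ => ht t t' φ
    have hP (c) := ha.time_independent hμ hμper (X := .P c) (by simp) t t' φ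
    have hG (c) := ha.time_independent hμ hμper (X := .G c) (by simp) t t' φ
    have hJ := ha.time_independent hμ hμper (X := .J) (by simp) t t' φ
    -- Only `h` can depend on time, and the bracket does not see it because `H` is central.
    have hlie : ⁅a t φ, Λ t φ⁆ = ⁅a t' φ, Λ t φ⁆ := by
      ext X
      rcases X with _ | c | _ | c <;> simp [bracket_H, bracket_P, bracket_J, bracket_G, hP, hG, hJ]
    simp [boundaryVariation, ← h, hlie]

end

theorem eq_zero_of_integral_eq_zero_of_periodic {f : ℝ → ℝ} {c : ℝ} (hc : 0 < c)
    (hf : Continuous f) (hnn : ∀ x, 0 ≤ f x) (hper : Function.Periodic f c)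
    (h : ∫ x in (0 : ℝ)..c, f x = 0) (x : ℝ) : f x = 0 := by
  by_contra hx
  have hpos := intervalIntegral.integral_pos (lt_add_of_pos_right x hc) hf.continuousOn
    (fun y _ => hnn y)
    ⟨x, Set.left_mem_Icc.2 (lt_add_of_pos_right x hc).le, (hnn x).lt_of_ne (Ne.symm hx)⟩
  -- Integrating over the period starting at `x` covers points outside `[0, c]` too.
  rw [hper.intervalIntegral_add_eq x 0, zero_add, h] at hpos
  exact hpos.false

/-! ### Charges -/

/-- The density of the boundary charge. -/
def chargeDensity (x y : Carroll ℝ) : ℝ :=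
  -(x .J * y .H) + ∑ c, (x (.P c) * y (.G c) + x (.G c) * y (.P c))

theorem contDiff_chargeDensity {E : Type*} [NormedAddCommGroup E] [NormedSpace ℝ E]
    {n : WithTop ℕ∞} {f g : E → Carroll ℝ} (hf : ∀ X, ContDiff ℝ n fun x => f x X)
    (hg : ∀ X, ContDiff ℝ n fun x => g x X) :
    ContDiff ℝ n fun x => chargeDensity (f x) (g x) := by
  unfold chargeDensity
  have := hf .J; have := hg .H
  have := fun a => hf (.P a); have := fun a => hf (.G a)
  have := fun a => hg (.P a); have := fun a => hg (.G a)
  fun_prop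

theorem intervalIntegrable_chargeDensity {Λ a : BoundaryField} (hΛ : Λ.SmoothPeriodic)
    (ha : a.SmoothPeriodic) (t b c : ℝ) : IntervalIntegrable
      (fun φ => chargeDensity (Λ t φ) (a t φ)) MeasureTheory.volume b c :=
  (contDiff_chargeDensity (BoundaryField.contDiff_angular hΛ t)
    (BoundaryField.contDiff_angular ha t)).continuous.intervalIntegrable _ _

theorem charge_add_smul (k : ℝ) {Λ a δ : BoundaryField} (hΛ : Λ.SmoothPeriodic)
    (ha : a.SmoothPeriodic) (hδ : δ.SmoothPeriodic) (t ε : ℝ) :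
    charge k Λ t (a + ε • δ) = charge k Λ t a + ε * charge k Λ t δ := by
  have h (φ : ℝ) : chargeDensity (Λ t φ) ((a + ε • δ) t φ)
      = chargeDensity (Λ t φ) (a t φ) + ε * chargeDensity (Λ t φ) (δ t φ) := by
    simp [chargeDensity, Fin.sum_univ_two]
    ring
  change _ * (∫ φ in _.._, chargeDensity _ _) = _ * (∫ φ in _.._, chargeDensity _ _)
    + _ * (_ * ∫ φ in _.._, chargeDensity _ _)
  simp only [h]
  rw [intervalIntegral.integral_add (intervalIntegrable_chargeDensity hΛ ha t _ _)
    ((intervalIntegrable_chargeDensity hΛ hδ t _ _).const_mul ε),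
    intervalIntegral.integral_const_mul]
  ring

theorem charge_add (k : ℝ) {Λ a δ : BoundaryField} (hΛ : Λ.SmoothPeriodic)
    (ha : a.SmoothPeriodic) (hδ : δ.SmoothPeriodic) (t : ℝ) :
    charge k Λ t (a + δ) = charge k Λ t a + charge k Λ t δ := by
  simpa using charge_add_smul k hΛ ha hδ t 1

/-- The metric differs from the charge density only by the term `-Λ^H δ^J`, which vanishes for
allowed variations. -/
theorem chargeVariation_dressed (k t ρ : ℝ) (Λ : BoundaryField) {δ : BoundaryField}
    (hδ : IsVariation δ) :
    chargeVariation k t ρ (dressed Λ) (connectionVariation δ) = charge k Λ t δ := by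
  have h (φ : ℝ) : metric (dressed Λ ![t, ρ, φ]) (connectionVariation δ 2 ![t, ρ, φ])
      = chargeDensity (Λ t φ) (δ t φ) := by
    refine (metric_radialConj ρ (Λ t φ) (δ t φ)).trans ?_
    simp [metric, chargeDensity, hδ.2]
  simp only [chargeVariation, h]
  rfl

theorem charge_finite_integrable (k : ℝ) {Λ a δ : BoundaryField} (hΛ : Λ.SmoothPeriodic)
    (ha : a.SmoothPeriodic) (hδ : IsVariation δ) (t : ℝ) :
    ∃ q : ℝ, (∀ ρ, chargeVariation k t ρ (dressed Λ) (connectionVariation δ) = q) ∧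
      Tendsto (fun ρ => chargeVariation k t ρ (dressed Λ) (connectionVariation δ)) atTop (𝓝 q) ∧
      HasDerivAt (fun ε : ℝ => charge k Λ t (a + ε • δ)) q 0 := by
  refine ⟨charge k Λ t δ, fun ρ => chargeVariation_dressed k t ρ Λ hδ, ?_, ?_⟩
  · simp only [chargeVariation_dressed k t _ Λ hδ]
    exact tendsto_const_nhds
  · simp only [charge_add_smul k hΛ ha hδ.1]
    simpa using ((hasDerivAt_id (0 : ℝ)).mul_const (charge k Λ t δ)).const_add (charge k Λ t a)

section

variable {μ : ℝ → ℝ → ℝ} (hμ : ContDiff ℝ ∞ (fun z : ℝ × ℝ => μ z.1 z.2))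
  (hμper : ∀ t φ : ℝ, μ t (φ + 2 * Real.pi) = μ t φ)

include hμ hμper

theorem charge_conserved (k : ℝ) {Λ a : BoundaryField} (hΛ : Admissible μ Λ) (ha : OnShell μ a)
    (t t' : ℝ) : charge k Λ t a = charge k Λ t' a := by
  obtain ⟨hs, ht, hJ⟩ := (admissible_iff μ Λ).1 hΛ
  -- The density and `Λ^J μ` form a conserved current: `∂_t(-Λ^J h) + ∂_φ(Λ^J μ) = 0`, all other
  -- terms being static.
  have h := integral2_deriv_of_periodic (f := fun z => chargeDensity (Λ z.1 z.2) (a z.1 z.2))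
    (g := fun z => Λ 0 0 .J * μ z.1 z.2) (contDiff_chargeDensity hs.1 ha.1.1.1)
    (contDiff_const.mul hμ) (fun x => by simpa using Or.inl (hμper x 0)) t' t
  have hint (x φ : ℝ) : deriv (fun u => chargeDensity (Λ u φ) (a u φ)) x
      + deriv (fun v => Λ 0 0 .J * μ x v) φ = 0 := by
    have h1 : (fun u => chargeDensity (Λ u φ) (a u φ)) = fun u => -(Λ 0 0 .J * a u φ .H)
        + ∑ c, (Λ 0 φ (.P c) * a 0 φ (.G c) + Λ 0 φ (.G c) * a 0 φ (.P c)) := by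
      funext u
      have hP (c) := ha.time_independent hμ hμper (X := .P c) (by simp) u 0 φ
      have hG (c) := ha.time_independent hμ hμper (X := .G c) (by simp) u 0 φ
      simp only [chargeDensity, ht u 0 φ, hJ 0 φ 0, hP, hG]
    have h2 := ((onShell_iff hμ hμper a).1 ha).2 x φ
    rw [h1, deriv_add_const, deriv.fun_neg, deriv_const_mul_field, deriv_const_mul_field, h2.2]
    ring
  simp only [hint, intervalIntegral.integral_zero] at h
  exact congrArg (_ * ·) (sub_eq_zero.1 h.symm)

theorem charge_constant_iff {k : ℝ} (hk : k ≠ 0) {Λ : BoundaryField} (hΛ : Admissible μ Λ) :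
    (∀ a b : BoundaryField, OnShell μ a → OnShell μ b → charge k Λ 0 a = charge k Λ 0 b) ↔
      ∀ t φ : ℝ, Λ t φ .J = 0 ∧ ∀ c, Λ t φ (.P c) = 0 ∧ Λ t φ (.G c) = 0 := by
  obtain ⟨hs, ht, hJ⟩ := (admissible_iff μ Λ).1 hΛ
  refine ⟨fun h => ?_, fun h a b _ _ => by simp [charge, h]⟩
  obtain ⟨a, ha⟩ := exists_onShell hμ hμper
  have hk' : k / (2 * Real.pi) ≠ 0 := div_ne_zero hk Real.two_pi_pos.ne'
  have hzero {δ : BoundaryField} (hδ : IsVariation δ) (hδt : ∀ t t' φ : ℝ, δ t φ = δ t' φ) :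
      ∫ φ in (0 : ℝ)..(2 * Real.pi), chargeDensity (Λ 0 φ) (δ 0 φ) = 0 := by
    have h1 := h _ _ (ha.add_of_dt_eq_zero hμ hμper hδ hδt) ha
    rw [charge_add k hs ha.1.1 hδ.1, add_eq_left] at h1
    exact (mul_eq_zero.1 h1).resolve_left hk'
  -- The variation dual to `Λ` under the pairing of `H` with `J` and of `P` with `G`; its charge
  -- density is a sum of squares.
  let δ : BoundaryField := fun t φ => ⟨fun
    | .H => -Λ t φ .J
    | .P c => Λ t φ (.G c)
    | .J => 0
    | .G c => Λ t φ (.P c)⟩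
  have hδ : IsVariation δ := by
    refine ⟨⟨fun X => ?_, fun t φ => by simp only [δ, hs.2]⟩, fun _ _ => rfl⟩
    rcases X with _ | c | _ | c
    · exact (hs.1 .J).neg
    · exact hs.1 (.G c)
    · exact contDiff_const
    · exact hs.1 (.P c)
  have hδ0 := hzero hδ fun t t' φ => by simp only [δ, ht t t' φ]
  have hpos (φ : ℝ) : chargeDensity (Λ 0 φ) (δ 0 φ) = (Λ 0 φ .J) ^ 2
      + ∑ c, ((Λ 0 φ (.P c)) ^ 2 + (Λ 0 φ (.G c)) ^ 2) := by
    simp [chargeDensity, δ, Fin.sum_univ_two]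
    ring
  have hcont := (contDiff_chargeDensity (BoundaryField.contDiff_angular hs 0)
    (BoundaryField.contDiff_angular hδ.1 0)).continuous
  have hnn (φ : ℝ) : 0 ≤ chargeDensity (Λ 0 φ) (δ 0 φ) := by
    rw [hpos]; positivity
  intro t φ
  have h0 := eq_zero_of_integral_eq_zero_of_periodic Real.two_pi_pos hcont hnn
    (fun φ => by simp only [hs.2, hδ.1.2]) hδ0 φ
  simp only [hpos, Fin.sum_univ_two] at h0
  rw [ht t 0 φ]
  have hsq {x : ℝ} (hx : x ^ 2 ≤ 0) : x = 0 := pow_eq_zero_iff two_ne_zero |>.1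
    (le_antisymm hx (sq_nonneg x))
  have hJ0 := sq_nonneg (Λ 0 φ .J)
  have hP0 := fun c => sq_nonneg (Λ 0 φ (.P c))
  have hG0 := fun c => sq_nonneg (Λ 0 φ (.G c))
  refine ⟨hsq ?_, Fin.forall_fin_two.2 ⟨⟨hsq ?_, hsq ?_⟩, hsq ?_, hsq ?_⟩⟩ <;>
    linarith [hP0 0, hP0 1, hG0 0, hG0 1]

end

/-! ### Double extension of a module with a skew form -/

/-- The double extension of a module `W` by the derivation `R`, with central cocycle `β`: elements
are `(c, j, w)` and `[(c, j, w), (c', j', w')] = (β w w', 0, j R w' - j' R w)`. -/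
def doubleExtensionBracket {𝕜 W : Type*} [CommRing 𝕜] [AddCommGroup W] [Module 𝕜 W]
    (R : W →ₗ[𝕜] W) (β : W →ₗ[𝕜] W →ₗ[𝕜] 𝕜) :
    (𝕜 × 𝕜 × W) →ₗ[𝕜] (𝕜 × 𝕜 × W) →ₗ[𝕜] (𝕜 × 𝕜 × W) :=
  LinearMap.mk₂ 𝕜 (fun x y => (β x.2.2 y.2.2, 0, x.2.1 • R y.2.2 - y.2.1 • R x.2.2))
    (fun x x' y => by
      simp only [Prod.fst_add, Prod.snd_add, map_add, LinearMap.add_apply, Prod.mk_add_mk, add_zero]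
      congr 2
      module)
    (fun c x y => by
      simp only [Prod.smul_fst, Prod.smul_snd, map_smul, LinearMap.smul_apply, Prod.smul_mk,
        smul_zero]
      congr 2
      module)
    (fun x y y' => by
      simp only [Prod.fst_add, Prod.snd_add, map_add, Prod.mk_add_mk, add_zero]
      congr 2
      module)
    (fun c x y => by
      simp only [Prod.smul_fst, Prod.smul_snd, map_smul, Prod.smul_mk, smul_zero]
      congr 2
      module)

section

variable {𝕜 W : Type*} [CommRing 𝕜] [AddCommGroup W] [Module 𝕜 W]
  {R : W →ₗ[𝕜] W} {β : W →ₗ[𝕜] W →ₗ[𝕜] 𝕜}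

theorem doubleExtensionBracket_apply (x y : 𝕜 × 𝕜 × W) : doubleExtensionBracket R β x y
    = (β x.2.2 y.2.2, 0, x.2.1 • R y.2.2 - y.2.1 • R x.2.2) := rfl

theorem doubleExtensionBracket_self (hβ : ∀ w, β w w = 0) (x : 𝕜 × 𝕜 × W) :
    doubleExtensionBracket R β x x = 0 := by
  simp [doubleExtensionBracket_apply, hβ]

/-- `W` is abelian up to the centre, so `R`-invariance of `β` is the only compatibility needed; the
`W`-component cancels identically. -/
theorem doubleExtensionBracket_jacobi (hβ : ∀ w, β w w = 0)
    (hR : ∀ w w', β (R w) w' + β w (R w') = 0) (x y z : 𝕜 × 𝕜 × W) :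
    doubleExtensionBracket R β x (doubleExtensionBracket R β y z)
      = doubleExtensionBracket R β (doubleExtensionBracket R β x y) z
        + doubleExtensionBracket R β y (doubleExtensionBracket R β x z) := by
  have hskew (w w') : β w' w = -β w w' := (LinearMap.IsAlt.neg hβ w w').symm
  simp only [doubleExtensionBracket_apply, map_sub, map_smul, LinearMap.sub_apply,
    LinearMap.smul_apply, Prod.mk_add_mk, add_zero, smul_eq_mul, zero_smul, zero_sub, sub_zero]
  refine Prod.ext ?_ (Prod.ext rfl ?_)
  · have h1 := hR x.2.2 z.2.2
    have h2 := hR x.2.2 y.2.2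
    have h3 := hskew (R x.2.2) y.2.2
    have h5 := hR y.2.2 z.2.2
    dsimp only
    linear_combination y.2.1 * h1 - z.2.1 * h2 + z.2.1 * h3 - x.2.1 * h5
  · dsimp only
    module

end

/-! ### Smooth functions on the circle -/

/-- The algebra of smooth complex `2π`-periodic functions. -/
def LoopFun : Subalgebra ℂ (ℝ → ℂ) where
  carrier := {f | ContDiff ℝ ∞ f ∧ Function.Periodic f (2 * Real.pi)}
  mul_mem' hf hg := ⟨hf.1.mul hg.1, hf.2.mul hg.2⟩
  add_mem' hf hg := ⟨hf.1.add hg.1, hf.2.add hg.2⟩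
  algebraMap_mem' _ := ⟨contDiff_const, fun _ => rfl⟩

namespace LoopFun

instance : CoeFun LoopFun (fun _ => ℝ → ℂ) := ⟨Subtype.val⟩

@[ext] theorem ext {f g : LoopFun} (h : ∀ φ, f φ = g φ) : f = g := Subtype.ext (funext h)

@[simp] theorem add_apply (f g : LoopFun) (φ : ℝ) : (f + g) φ = f φ + g φ := rfl
@[simp] theorem sub_apply (f g : LoopFun) (φ : ℝ) : (f - g) φ = f φ - g φ := rfl
@[simp] theorem neg_apply (f : LoopFun) (φ : ℝ) : (-f) φ = -f φ := rfl
@[simp] theorem mul_apply (f g : LoopFun) (φ : ℝ) : (f * g) φ = f φ * g φ := rfl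
@[simp] theorem smul_apply (c : ℂ) (f : LoopFun) (φ : ℝ) : (c • f) φ = c * f φ := rfl
@[simp] theorem zero_apply (φ : ℝ) : (0 : LoopFun) φ = 0 := rfl
@[simp] theorem one_apply (φ : ℝ) : (1 : LoopFun) φ = 1 := rfl

theorem continuous (f : LoopFun) : Continuous f := f.2.1.continuous

theorem differentiable (f : LoopFun) : Differentiable ℝ f := f.2.1.differentiable (by simp)

theorem intervalIntegrable (f : LoopFun) (a b : ℝ) :
    IntervalIntegrable f MeasureTheory.volume a b := (continuous f).intervalIntegrable a b

/-- The derivative. -/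
noncomputable def D : LoopFun →ₗ[ℂ] LoopFun where
  toFun f := ⟨deriv f, (contDiff_infty_iff_deriv.1 f.2.1).2, deriv_periodic f.2.2⟩
  map_add' f g := ext fun φ => deriv_add (LoopFun.differentiable f φ) (LoopFun.differentiable g φ)
  map_smul' c _ := ext fun _ => deriv_const_smul_field c _

theorem D_apply (f : LoopFun) (φ : ℝ) : D f φ = deriv f φ := rfl

theorem D_mul (f g : LoopFun) : D (f * g) = D f * g + f * D g :=
  ext fun φ => deriv_mul (LoopFun.differentiable f φ) (LoopFun.differentiable g φ)

theorem D_one : D 1 = 0 := ext fun φ => deriv_const φ _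

/-- The integral over the circle. -/
noncomputable def I : LoopFun →ₗ[ℂ] ℂ where
  toFun f := ∫ φ in (0 : ℝ)..(2 * Real.pi), f φ
  map_add' f g := intervalIntegral.integral_add (intervalIntegrable f _ _)
    (intervalIntegrable g _ _)
  map_smul' c _ := intervalIntegral.integral_const_mul c _

theorem I_apply (f : LoopFun) : I f = ∫ φ in (0 : ℝ)..(2 * Real.pi), f φ := rfl

theorem I_D (f : LoopFun) : I (D f) = 0 := by
  rw [I_apply]
  simp only [D_apply]
  rw [intervalIntegral.integral_deriv_eq_sub (fun φ _ => LoopFun.differentiable f φ)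
    (LoopFun.intervalIntegrable (D f) _ _), sub_eq_zero]
  simpa using f.2.2 0

theorem I_one : I 1 = 2 * Real.pi := by
  simp [I_apply]

/-- The exponential `e^{-inφ}`. -/
noncomputable def E (n : ℤ) : LoopFun :=
  ⟨fun φ => Complex.exp (-(Complex.I * n * φ)), by
    refine ⟨?_, fun φ => ?_⟩
    · exact (contDiff_const.mul Complex.ofRealCLM.contDiff).neg.cexp
    · rw [Complex.exp_eq_exp_iff_exists_int]
      exact ⟨-n, by push_cast; ring⟩⟩

theorem E_apply (n : ℤ) (φ : ℝ) : E n φ = Complex.exp (-(Complex.I * n * φ)) := rfl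

theorem E_zero : E 0 = 1 := ext fun φ => by simp [E_apply]

theorem E_mul (n m : ℤ) : E n * E m = E (n + m) := ext fun φ => by
  simp only [mul_apply, E_apply, ← Complex.exp_add]
  congr 1
  push_cast
  ring

theorem D_E (n : ℤ) : D (E n) = (-(Complex.I * n)) • E n := ext fun φ => by
  have h : HasDerivAt (fun φ : ℝ => -(Complex.I * n * (φ : ℂ))) (-(Complex.I * n)) φ := by
    simpa using ((Complex.ofRealCLM.hasDerivAt (x := φ)).const_mul (Complex.I * (n : ℂ))).fun_neg
  rw [smul_apply, mul_comm]
  exact h.cexp.deriv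

theorem I_E (n : ℤ) : I (E n) = if n = 0 then 2 * (Real.pi : ℂ) else 0 := by
  split_ifs with h
  · rw [h, E_zero, I_one]
  -- For `n ≠ 0` the exponential is, up to the factor `-in`, its own derivative.
  · have h0 := I_D (E n)
    rw [D_E, map_smul, smul_eq_zero] at h0
    refine h0.resolve_left ?_
    simp [h]

/-- The loop function of a smooth real function. -/
def ofReal (f : ℝ → ℝ) (hf : ContDiff ℝ ∞ f) (hper : Function.Periodic f (2 * Real.pi)) : LoopFun :=
  ⟨fun φ => (f φ : ℂ), Complex.ofRealCLM.contDiff.comp hf, fun φ => by simp only [hper φ]⟩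

/-- Testing against `Re f` and `Im f` gives vanishing integrals of their squares. The test functions
must be real since they will be variations of real fields. -/
theorem I_mul_eq_zero {f : LoopFun}
    (h : ∀ (g : ℝ → ℝ) (hg : ContDiff ℝ ∞ g) (hper : Function.Periodic g (2 * Real.pi)),
      I (f * ofReal g hg hper) = 0) : f = 0 := by
  have hre : ContDiff ℝ ∞ fun φ => (f φ).re := Complex.reCLM.contDiff.comp f.2.1
  have him : ContDiff ℝ ∞ fun φ => (f φ).im := Complex.imCLM.contDiff.comp f.2.1
  have hint (g : LoopFun) : IntervalIntegrable g MeasureTheory.volume 0 (2 * Real.pi) :=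
    LoopFun.intervalIntegrable g _ _
  have h1 := congrArg Complex.re (h _ hre fun φ => by simp only [f.2.2 φ])
  have h2 := congrArg Complex.im (h _ him fun φ => by simp only [f.2.2 φ])
  rw [I_apply, ← Complex.reCLM_apply, ← Complex.reCLM.intervalIntegral_comp_comm (hint _)] at h1
  rw [I_apply, ← Complex.imCLM_apply, ← Complex.imCLM.intervalIntegral_comp_comm (hint _)] at h2
  simp [ofReal] at h1 h2
  ext φ
  have e1 := eq_zero_of_integral_eq_zero_of_periodic Real.two_pi_pos
    (hre.continuous.mul hre.continuous)
    (fun φ => mul_self_nonneg _) (fun φ => by simp only [f.2.2 φ, Pi.mul_apply]) h1 φ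
  have e2 := eq_zero_of_integral_eq_zero_of_periodic Real.two_pi_pos
    (him.continuous.mul him.continuous)
    (fun φ => mul_self_nonneg _) (fun φ => by simp only [f.2.2 φ, Pi.mul_apply]) h2 φ
  exact Complex.ext (mul_self_eq_zero.1 e1) (mul_self_eq_zero.1 e2)

end LoopFun

/-! ### The rotation and the cocycle on pairs of loop functions -/

/-- The components along `P_a` and `G_a` of a complexified gauge parameter. -/
abbrev LoopPair : Type := (Fin 2 → LoopFun) × (Fin 2 → LoopFun)

/-- The action of `J`. -/
def loopRotation : LoopPair →ₗ[ℂ] LoopPair where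
  toFun w := (fun b => ∑ a, (eps a b : ℂ) • w.1 a, fun b => ∑ a, (eps a b : ℂ) • w.2 a)
  map_add' w w' := by
    refine Prod.ext (funext fun b => ?_) (funext fun b => ?_) <;>
      simp [Finset.sum_add_distrib]
  map_smul' c w := by
    refine Prod.ext (funext fun b => ?_) (funext fun b => ?_) <;>
      simp [smul_comm c]

open LoopFun in
/-- The central cocycle at level `k`. -/
noncomputable def loopCocycle (k : ℝ) : LoopPair →ₗ[ℂ] LoopPair →ₗ[ℂ] ℂ :=
  LinearMap.mk₂ ℂ (fun w w' => ((k / (2 * Real.pi) : ℝ) : ℂ) *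
      I (∑ a, (w'.1 a * D (w.2 a) + w'.2 a * D (w.1 a))
        - ∑ a, ∑ b, (eps a b : ℂ) • (w.1 a * w'.2 b - w'.1 a * w.2 b)))
    (fun w₁ w₂ w' => by
      rw [← mul_add, ← map_add]
      congr 2
      simp only [Prod.fst_add, Prod.snd_add, Pi.add_apply, map_add, Fin.sum_univ_two, smul_sub,
        mul_add, add_mul, smul_add]
      abel)
    (fun c w w' => by
      rw [smul_eq_mul, mul_left_comm, ← smul_eq_mul c, ← map_smul]
      congr 2
      simp only [Prod.smul_fst, Prod.smul_snd, Pi.smul_apply, map_smul, Fin.sum_univ_two, smul_sub,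
        smul_add, mul_smul_comm, smul_mul_assoc, smul_comm c])
    (fun w w₁ w₂ => by
      rw [← mul_add, ← map_add]
      congr 2
      simp only [Prod.fst_add, Prod.snd_add, Pi.add_apply, Fin.sum_univ_two, smul_sub,
        mul_add, add_mul, smul_add]
      abel)
    (fun c w w' => by
      rw [smul_eq_mul, mul_left_comm, ← smul_eq_mul c, ← map_smul]
      congr 2
      simp only [Prod.smul_fst, Prod.smul_snd, Pi.smul_apply, Fin.sum_univ_two, smul_sub,
        smul_add, mul_smul_comm, smul_mul_assoc, smul_comm c])

open LoopFun in
theorem loopCocycle_apply (k : ℝ) (w w' : LoopPair) :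
    loopCocycle k w w' = ((k / (2 * Real.pi) : ℝ) : ℂ) *
      I (∑ a, (w'.1 a * D (w.2 a) + w'.2 a * D (w.1 a))
        - ∑ a, ∑ b, (eps a b : ℂ) • (w.1 a * w'.2 b - w'.1 a * w.2 b)) := rfl

open LoopFun in
-- The `ε` part vanishes pointwise, the derivative part only after integration, as a total
-- derivative.
theorem loopCocycle_self (k : ℝ) (w : LoopPair) : loopCocycle k w w = 0 := by
  have h (a) : w.1 a * D (w.2 a) + w.2 a * D (w.1 a) = D (w.1 a * w.2 a) := by
    rw [D_mul]
    ring
  simp only [loopCocycle_apply, sub_self, smul_zero, Finset.sum_const_zero, sub_zero, h, map_sum,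
    I_D, mul_zero]

open LoopFun in
-- Both `δ_ab` and `ε_ab` are rotation invariant, and the rotation is constant so it commutes with
-- `D`: the integrand vanishes pointwise.
theorem loopCocycle_rotation (k : ℝ) (w w' : LoopPair) :
    loopCocycle k (loopRotation w) w' + loopCocycle k w (loopRotation w') = 0 := by
  rw [loopCocycle_apply, loopCocycle_apply, ← mul_add, ← map_add]
  convert mul_zero _
  convert map_zero I
  simp [loopRotation, eps, Fin.sum_univ_two]
  ring

/-! ### Charges as functionals of loop functions -/

/-- A component of a field at `t = 0`, as a loop function. -/
def BoundaryField.loop (f : BoundaryField) (hf : f.SmoothPeriodic) (X : CarrollGen) : LoopFun :=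
  LoopFun.ofReal (fun φ => f 0 φ X) (BoundaryField.contDiff_angular hf 0 X)
    fun φ => by simp only [hf.2]

theorem BoundaryField.loop_apply (f : BoundaryField) (hf : f.SmoothPeriodic) (X : CarrollGen)
    (φ : ℝ) : f.loop hf X φ = (f 0 φ X : ℂ) := rfl

/-- Complexified gauge parameters up to trivial ones, centrally extended: triples of a constant, the
component along `J`, and the components along `P_a` and `G_a`. -/
abbrev ChargeParam : Type := ℂ × ℂ × LoopPair

/-- The complexified charge density. -/
def ChargeParam.density (x : ChargeParam) (a : BoundaryField) (ha : a.SmoothPeriodic) : LoopFun :=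
  -(x.2.1 • a.loop ha .H) + ∑ c, (x.2.2.1 c * a.loop ha (.G c) + x.2.2.2 c * a.loop ha (.P c))

theorem ChargeParam.density_apply (x : ChargeParam) (a : BoundaryField) (ha : a.SmoothPeriodic)
    (φ : ℝ) : x.density a ha φ = -(x.2.1 * a 0 φ .H)
      + ∑ c, (x.2.2.1 c φ * a 0 φ (.G c) + x.2.2.2 c φ * a 0 φ (.P c)) := by
  simp [ChargeParam.density, BoundaryField.loop_apply, Fin.sum_univ_two]

open LoopFun in
/-- The functional on the space of solutions belonging to a parameter. -/
noncomputable def chargeMap (μ : ℝ → ℝ → ℝ) (k : ℝ) : ChargeParam →ₗ[ℂ] SolutionSpace μ → ℂ where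
  toFun x s := x.1 + ((k / (2 * Real.pi) : ℝ) : ℂ) * I (x.density s.1 s.2.1.1)
  map_add' x y := by
    funext s
    have h : (x + y).density s.1 s.2.1.1 = x.density s.1 s.2.1.1 + y.density s.1 s.2.1.1 := by
      ext φ
      simp [ChargeParam.density_apply, Fin.sum_univ_two]
      ring
    simp only [h, map_add, Prod.fst_add, Pi.add_apply]
    ring
  map_smul' c x := by
    funext s
    have h : (c • x).density s.1 s.2.1.1 = c • x.density s.1 s.2.1.1 := by
      ext φ
      simp [ChargeParam.density_apply, Fin.sum_univ_two]
      ring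
    simp only [h, map_smul, Prod.smul_fst, Pi.smul_apply, smul_eq_mul, RingHom.id_apply]
    ring

open LoopFun in
theorem chargeMap_apply (μ : ℝ → ℝ → ℝ) (k : ℝ) (x : ChargeParam) (s : SolutionSpace μ) :
    chargeMap μ k x s
      = x.1 + ((k / (2 * Real.pi) : ℝ) : ℂ) * I (x.density s.1 s.2.1.1) := rfl

/-- The parameter of the charge of a gauge transformation. -/
def BoundaryField.param (Λ : BoundaryField) (hΛ : Λ.SmoothPeriodic) : ChargeParam :=
  (0, (Λ 0 0 .J : ℂ), fun c => Λ.loop hΛ (.P c), fun c => Λ.loop hΛ (.G c))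

theorem chargeMap_param {μ : ℝ → ℝ → ℝ} (k : ℝ) {Λ : BoundaryField} (hΛ : Admissible μ Λ) :
    chargeMap μ k (Λ.param hΛ.1) = chargeFunctional μ k Λ := by
  obtain ⟨hs, ht, hJ⟩ := (admissible_iff μ Λ).1 hΛ
  funext s
  have h (φ : ℝ) : (Λ.param hΛ.1).density s.1 s.2.1.1 φ
      = ((chargeDensity (Λ 0 φ) (s.1 0 φ) : ℝ) : ℂ) := by
    rw [ChargeParam.density_apply, chargeDensity, hJ 0 φ 0]
    push_cast
    rfl
  rw [chargeMap_apply, LoopFun.I_apply]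
  simp only [h]
  rw [intervalIntegral.integral_ofReal, ← Complex.ofReal_mul]
  exact zero_add _

section

variable {μ : ℝ → ℝ → ℝ} (hμ : ContDiff ℝ ∞ (fun z : ℝ × ℝ => μ z.1 z.2))
  (hμper : ∀ t φ : ℝ, μ t (φ + 2 * Real.pi) = μ t φ)

include hμ hμper

open LoopFun in
theorem chargeMap_injective {k : ℝ} (hk : k ≠ 0) : Function.Injective (chargeMap μ k) := by
  rw [injective_iff_map_eq_zero]
  intro x hx
  obtain ⟨a, ha⟩ := exists_onShell hμ hμper
  have hk' : ((k / (2 * Real.pi) : ℝ) : ℂ) ≠ 0 :=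
    Complex.ofReal_ne_zero.2 (div_ne_zero hk Real.two_pi_pos.ne')
  -- Comparing two solutions eliminates the constant part of the parameter.
  have hvar {δ : BoundaryField} (hδ : IsVariation δ) (ht : ∀ t t' φ : ℝ, δ t φ = δ t' φ) :
      I (x.density δ hδ.1) = 0 := by
    have h1 := congrFun hx ⟨a, ha⟩
    have h2 := congrFun hx ⟨a + δ, ha.add_of_dt_eq_zero hμ hμper hδ ht⟩
    have h : x.density (a + δ) (ha.1.1.add hδ.1) = x.density a ha.1.1 + x.density δ hδ.1 := by
      ext φ
      simp [ChargeParam.density_apply, Fin.sum_univ_two]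
      ring
    rw [chargeMap_apply] at h1 h2
    simp only [h, map_add, mul_add, ← add_assoc, h1, Pi.zero_apply, zero_add] at h2
    exact (mul_eq_zero.1 h2).resolve_left hk'
  have hgen {g : ℝ → ℝ} (hg : ContDiff ℝ ∞ g) (hper : Function.Periodic g (2 * Real.pi))
      {X : CarrollGen} (hX : X ≠ .J) : IsVariation fun _ φ => g φ • gen X := by
    refine ⟨⟨fun Y => (hg.comp contDiff_snd).mul contDiff_const, fun t φ => ?_⟩, fun t φ => ?_⟩
    · simp only [hper φ]
    · simp [hX.symm]
  have hJ : x.2.1 = 0 := by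
    have h := hvar (hgen contDiff_const (fun _ => rfl) (g := fun _ => 1) (X := .H) (by simp))
      fun _ _ _ => rfl
    have h1 : x.density _ (hgen contDiff_const (fun _ => rfl) (g := fun _ => 1) (X := .H)
        (by simp)).1 = -x.2.1 • 1 := by
      ext φ
      simp [ChargeParam.density_apply]
    rw [h1, map_smul, I_one, smul_eq_mul, mul_eq_zero] at h
    simpa using h
  have hP (c) : x.2.2.1 c = 0 := by
    refine I_mul_eq_zero fun g hg hper => ?_
    -- The metric pairs `P` with `G`, so varying `g_c` isolates the parameter along `P_c`.
    rw [← hvar (hgen hg hper (X := .G c) (by simp)) fun _ _ _ => rfl]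
    congr 1
    ext φ
    fin_cases c <;> simp [ChargeParam.density_apply, ofReal]
  have hG (c) : x.2.2.2 c = 0 := by
    refine I_mul_eq_zero fun g hg hper => ?_
    rw [← hvar (hgen hg hper (X := .P c) (by simp)) fun _ _ _ => rfl]
    congr 1
    ext φ
    fin_cases c <;> simp [ChargeParam.density_apply, ofReal]
  have hc : x.1 = 0 := by
    have h := congrFun hx ⟨a, ha⟩
    have h0 : x.density a ha.1.1 = 0 := by
      ext φ
      simp [ChargeParam.density_apply, hJ, hP, hG]
    simpa [chargeMap_apply, h0] using h
  exact Prod.ext hc (Prod.ext hJ (Prod.ext (funext hP) (funext hG)))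

end

/-- The real gauge parameter made of the real parts of loop functions. -/
def LoopPair.reField (w : LoopPair) : BoundaryField := fun _ φ => ⟨fun
  | .P c => (w.1 c φ).re
  | .G c => (w.2 c φ).re
  | _ => 0⟩

theorem LoopPair.reField_smoothPeriodic (w : LoopPair) : w.reField.SmoothPeriodic := by
  refine ⟨fun X => ?_, fun t φ => ?_⟩
  · have h (f : LoopFun) : ContDiff ℝ ∞ fun z : ℝ × ℝ => (f z.2).re :=
      (Complex.reCLM.contDiff.comp f.2.1).comp contDiff_snd
    rcases X with _ | c | _ | c
    · exact contDiff_const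
    · exact h (w.1 c)
    · exact contDiff_const
    · exact h (w.2 c)
  · have h (f : LoopFun) : f (φ + 2 * Real.pi) = f φ := f.2.2 φ
    simp only [LoopPair.reField, h]

theorem LoopPair.reField_admissible (μ : ℝ → ℝ → ℝ) (w : LoopPair) : Admissible μ w.reField :=
  (admissible_iff μ _).2 ⟨w.reField_smoothPeriodic, fun _ _ _ => rfl, fun _ _ _ => rfl⟩

theorem admissible_const (μ : ℝ → ℝ → ℝ) (x : Carroll ℝ) : Admissible μ fun _ _ => x :=
  (admissible_iff μ _).2 ⟨.const x, fun _ _ _ => rfl, fun _ _ _ => rfl⟩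

/-- Gauge parameters are real, so complex loops are split as `w = Re w + i Re(-i w)`. This makes
`chargeMap` land in the span of charges and constants. -/
theorem ChargeParam.decomposition (x : ChargeParam) : x = x.1 • ((1, 0, 0) : ChargeParam)
    + x.2.1 • BoundaryField.param (fun _ _ => gen .J) (.const _)
    + (x.2.2.reField.param x.2.2.reField_smoothPeriodic
    + Complex.I • ((-Complex.I) • x.2.2).reField.param
        (LoopPair.reField_smoothPeriodic ((-Complex.I) • x.2.2))) := by
  have h (z : ℂ) : z = z.re + Complex.I * (-Complex.I * z).re := by
    simp [mul_comm Complex.I]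
  refine Prod.ext ?_ (Prod.ext ?_ (Prod.ext (funext fun c => ?_) (funext fun c => ?_)))
  · simp [BoundaryField.param]
  · simp [BoundaryField.param, LoopPair.reField]
  · ext φ
    simpa [BoundaryField.param, LoopPair.reField, BoundaryField.loop_apply] using h (x.2.2.1 c φ)
  · ext φ
    simpa [BoundaryField.param, LoopPair.reField, BoundaryField.loop_apply] using h (x.2.2.2 c φ)

theorem chargeMap_one (μ : ℝ → ℝ → ℝ) (k : ℝ) : chargeMap μ k (1, 0, 0) = 1 := by
  funext s
  have h : ChargeParam.density (1, 0, 0) s.1 s.2.1.1 = 0 := by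
    ext φ
    simp [ChargeParam.density_apply]
  simp [chargeMap_apply, h]

theorem chargeFunctional_mem (μ : ℝ → ℝ → ℝ) (k : ℝ) {Λ : BoundaryField} (hΛ : Admissible μ Λ) :
    chargeFunctional μ k Λ ∈ ChargeSpace μ k :=
  Submodule.subset_span (Or.inr ⟨Λ, hΛ, rfl⟩)

theorem one_mem_chargeSpace (μ : ℝ → ℝ → ℝ) (k : ℝ) : 1 ∈ ChargeSpace μ k :=
  Submodule.subset_span (Or.inl rfl)

theorem range_chargeMap (μ : ℝ → ℝ → ℝ) (k : ℝ) :
    LinearMap.range (chargeMap μ k) = ChargeSpace μ k := by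
  refine le_antisymm ?_ (Submodule.span_le.2 ?_)
  · rintro _ ⟨x, rfl⟩
    rw [x.decomposition]
    simp only [map_add, map_smul, chargeMap_one]
    have hp {Λ : BoundaryField} (hΛ : Admissible μ Λ) :
        chargeMap μ k (Λ.param hΛ.1) ∈ ChargeSpace μ k := by
      rw [chargeMap_param k hΛ]
      exact chargeFunctional_mem μ k hΛ
    exact add_mem (add_mem (Submodule.smul_mem _ _ (one_mem_chargeSpace μ k))
      (Submodule.smul_mem _ _ (hp (admissible_const μ _))))
      (add_mem (hp (LoopPair.reField_admissible μ _))
        (Submodule.smul_mem _ _ (hp (LoopPair.reField_admissible μ _))))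
  · rintro F (rfl | ⟨Λ, hΛ, rfl⟩)
    · exact ⟨_, chargeMap_one μ k⟩
    · exact ⟨_, chargeMap_param k hΛ⟩

/-! ### The gauge variation of the charges -/

open LoopFun in
theorem BoundaryField.loop_dφ (f : BoundaryField) (hf : f.SmoothPeriodic) (X : CarrollGen) :
    f.dφ.loop hf.dφ X = D (f.loop hf X) := by
  ext φ
  exact (BoundaryField.hasDerivAt_angular hf 0 φ X).ofReal_comp.deriv.symm

/-- The bracket of parameters. -/
noncomputable def paramBracket (k : ℝ) : ChargeParam →ₗ[ℂ] ChargeParam →ₗ[ℂ] ChargeParam :=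
  doubleExtensionBracket loopRotation (loopCocycle k)

open LoopFun in
-- The heart of the algebra: terms linear in the fields form the rotated parameters, while `∂_φ Λ`
-- and the brackets with the fixed `-J` give the field-independent cocycle.
theorem chargeMap_paramBracket {μ : ℝ → ℝ → ℝ} (k : ℝ) {Λ : BoundaryField} (hΛ : Admissible μ Λ)
    (x : ChargeParam) (s : SolutionSpace μ) :
    chargeMap μ k (paramBracket k (Λ.param hΛ.1) x) s = ((k / (2 * Real.pi) : ℝ) : ℂ) *
      I (x.density (boundaryVariation Λ s.1) (hΛ.1.boundaryVariation s.2.1.1)) := by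
  obtain ⟨hs, ht, hJ⟩ := (admissible_iff μ Λ).1 hΛ
  rw [chargeMap_apply, paramBracket, doubleExtensionBracket_apply, loopCocycle_apply, ← mul_add,
    ← map_add]
  congr 1
  rw [← sub_eq_zero, ← map_sub]
  have h (z : ℂ) : (∑ a, (x.2.2.1 a * D ((Λ.param hΛ.1).2.2.2 a)
          + x.2.2.2 a * D ((Λ.param hΛ.1).2.2.1 a))
        - ∑ a, ∑ b, (eps a b : ℂ) • ((Λ.param hΛ.1).2.2.1 a * x.2.2.2 b
          - x.2.2.1 a * (Λ.param hΛ.1).2.2.2 b))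
      + ChargeParam.density (z, 0,
          (Λ.param hΛ.1).2.1 • loopRotation x.2.2 - x.2.1 • loopRotation (Λ.param hΛ.1).2.2)
          s.1 s.2.1.1
      - x.density (boundaryVariation Λ s.1) (hΛ.1.boundaryVariation s.2.1.1)
      -- The only place where `Λ^H` enters; it integrates to zero. The first slot `z` is free
      -- because the density ignores it.
      = D (x.2.1 • Λ.loop hs .H) := by
    ext φ
    rw [map_smul]
    simp only [ChargeParam.density_apply, boundaryVariation_eq, BoundaryField.param,
      ← BoundaryField.loop_dφ, Fin.sum_univ_two, loopRotation, LinearMap.coe_mk, AddHom.coe_mk,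
      add_apply, sub_apply, mul_apply, smul_apply, BoundaryField.loop_apply, add_coeff,
      bracket_H, bracket_P, bracket_G, s.2.1.2, hJ 0 φ 0, Prod.fst_sub, Prod.snd_sub, Prod.smul_fst,
      Prod.smul_snd, Pi.sub_apply, Pi.smul_apply]
    simp [eps]
    ring
  exact (congrArg I (h _)).trans (I_D _)

theorem hasGaugeVariation_chargeMap {μ : ℝ → ℝ → ℝ} (k : ℝ) {Λ : BoundaryField}
    (hΛ : Admissible μ Λ) (x : ChargeParam) :
    HasGaugeVariation μ Λ (chargeMap μ k x) (chargeMap μ k (paramBracket k (Λ.param hΛ.1) x)) := by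
  intro a c hc
  have h (ε : ℝ) : chargeMap μ k x (c ε)
      = chargeMap μ k x a + (ε : ℂ) * chargeMap μ k (paramBracket k (Λ.param hΛ.1) x) a := by
    have hd : x.density (c ε).1 (c ε).2.1.1 = x.density a.1 a.2.1.1
        + (ε : ℂ) • x.density (boundaryVariation Λ a.1) (hΛ.1.boundaryVariation a.2.1.1) := by
      ext φ
      simp [ChargeParam.density_apply, hc, Fin.sum_univ_two]
      ring
    rw [chargeMap_paramBracket k hΛ, chargeMap_apply, chargeMap_apply, hd, map_add, map_smul,
      smul_eq_mul]
    ring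
  simp only [h]
  simpa using ((Complex.ofRealCLM.hasDerivAt (x := (0 : ℝ))).mul_const
    (chargeMap μ k (paramBracket k (Λ.param hΛ.1) x) a)).const_add (chargeMap μ k x a)

/-! ### Fourier modes -/

namespace LoopFun

/-- A loop function, as a continuous function on the circle. -/
noncomputable def toCircle (f : LoopFun) : C(AddCircle (2 * Real.pi), ℂ) where
  toFun := Function.Periodic.lift (f := f) f.2.2
  continuous_toFun := continuous_coinduced_dom.mpr (continuous f)

theorem integral_toCircle [Fact (0 < 2 * Real.pi)] (f : LoopFun) :
    ∫ x, toCircle f x ∂AddCircle.haarAddCircle = (2 * Real.pi : ℂ)⁻¹ * I f := by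
  rw [AddCircle.integral_haarAddCircle, ← AddCircle.intervalIntegral_preimage _ 0, zero_add,
    Complex.real_smul]
  push_cast
  rfl

theorem toCircle_mul (f g : LoopFun) (x : AddCircle (2 * Real.pi)) :
    toCircle f x * toCircle g x = toCircle (f * g) x := by
  induction x using QuotientAddGroup.induction_on with
  | H φ => rfl

/-- The sign flips because `E n` is `e^{-inφ}`. -/
theorem fourier_eq_toCircle (n : ℤ) (x : AddCircle (2 * Real.pi)) :
    fourier n x = toCircle (E (-n)) x := by
  induction x using QuotientAddGroup.induction_on with
  | H φ =>
    refine fourier_coe_apply.trans ((congrArg Complex.exp ?_).trans (E_apply _ _).symm)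
    have : (Real.pi : ℂ) ≠ 0 := Complex.ofReal_ne_zero.2 Real.pi_ne_zero
    push_cast
    field_simp

/-- Parseval's identity. -/
theorem hasSum_I_mul_I (f g : LoopFun) :
    HasSum (fun n : ℤ => (2 * Real.pi : ℂ)⁻¹ * I (E (-n) * f) * I (E n * g)) (I (f * g)) := by
  have : Fact (0 < 2 * Real.pi) := ⟨Real.two_pi_pos⟩
  have hpi : (2 * Real.pi : ℂ) ≠ 0 := by exact_mod_cast Real.two_pi_pos.ne'
  have hconj (n : ℤ) (x : AddCircle (2 * Real.pi)) :
      (starRingEnd ℂ) (toCircle (E (-n)) x) = toCircle (E n) x := by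
    rw [← fourier_eq_toCircle, ← fourier_neg, fourier_eq_toCircle, neg_neg]
  -- The inner product is conjugate-linear in its first slot; `star` undoes this and yields a
  -- bilinear identity.
  have h := (fourierBasis (T := 2 * Real.pi)).hasSum_inner_mul_inner
    (ContinuousMap.toLp 2 AddCircle.haarAddCircle ℂ (star (toCircle f)))
    (ContinuousMap.toLp 2 AddCircle.haarAddCircle ℂ (toCircle g))
  simp only [coe_fourierBasis, fourierLp, MeasureTheory.ContinuousMap.inner_toLp,
    ContinuousMap.star_apply, RCLike.star_def, Complex.conj_conj, hconj, fourier_eq_toCircle, toCircle_mul,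
    integral_toCircle] at h
  -- The Haar measure has total mass one, whence the factor `2π`.
  have h2 := h.mul_left (2 * Real.pi : ℂ)
  rw [mul_inv_cancel_left₀ hpi, mul_comm g f] at h2
  refine (congrArg (HasSum · _) (funext fun n => ?_)).mp h2
  rw [mul_comm g (E n)]
  field_simp

end LoopFun

open LoopFun

theorem parameterMode_eq (Λ : BoundaryField) (hΛ : Λ.SmoothPeriodic) (X : CarrollGen) (n : ℤ) :
    parameterMode Λ X n = (2 * Real.pi : ℂ)⁻¹ * I (E (-n) * Λ.loop hΛ X) := by
  have h (φ : ℝ) : (E (-n) * Λ.loop hΛ X) φ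
      = Complex.exp (Complex.I * n * φ) * ((Λ 0 φ X : ℝ) : ℂ) := by
    simp [E_apply, BoundaryField.loop_apply]
  rw [parameterMode, I_apply]
  simp only [h]
  push_cast
  rw [one_div]

/-- The parameters of the generators. -/
noncomputable def AsymptoticGen.param (k : ℝ) : AsymptoticGen → ChargeParam
  | .H => (k, 0, 0)
  | .J => (0, 1, 0)
  | .P a n => (0, 0, Pi.single a (E n), 0)
  | .G a n => (0, 0, 0, Pi.single a (E n))

theorem asymptoticCharge_P {μ : ℝ → ℝ → ℝ} (k : ℝ) (a : Fin 2) (n : ℤ) (s : SolutionSpace μ) :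
    asymptoticCharge μ k (.P a n) s
      = ((k / (2 * Real.pi) : ℝ) : ℂ) * I (E n * s.1.loop s.2.1.1 (.G a)) := by
  have h (φ : ℝ) : metric (gen (.P a)) (s.1 0 φ) = s.1 0 φ (.G a) := by
    fin_cases a <;> simp [metric]
  simp only [asymptoticCharge, chargeMode, h]
  rfl

theorem asymptoticCharge_G {μ : ℝ → ℝ → ℝ} (k : ℝ) (a : Fin 2) (n : ℤ) (s : SolutionSpace μ) :
    asymptoticCharge μ k (.G a n) s
      = ((k / (2 * Real.pi) : ℝ) : ℂ) * I (E n * s.1.loop s.2.1.1 (.P a)) := by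
  have h (φ : ℝ) : metric (gen (.G a)) (s.1 0 φ) = s.1 0 φ (.P a) := by
    fin_cases a <;> simp [metric]
  simp only [asymptoticCharge, chargeMode, h]
  rfl

theorem asymptoticCharge_J {μ : ℝ → ℝ → ℝ} (k : ℝ) (s : SolutionSpace μ) :
    asymptoticCharge μ k .J s
      = ((k / (2 * Real.pi) : ℝ) : ℂ) * I (-s.1.loop s.2.1.1 .H) := by
  have h (φ : ℝ) : Complex.exp (-(Complex.I * (0 : ℤ) * φ)) *
      ((metric (gen .J) (s.1 0 φ) : ℝ) : ℂ) = (-s.1.loop s.2.1.1 .H : LoopFun) φ := by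
    simp [metric, BoundaryField.loop_apply]
  simp only [asymptoticCharge, chargeMode, h]
  rfl

theorem asymptoticCharge_H {μ : ℝ → ℝ → ℝ} (k : ℝ) (s : SolutionSpace μ) :
    asymptoticCharge μ k .H s = k := by
  have h (φ : ℝ) : Complex.exp (-(Complex.I * (0 : ℤ) * φ)) *
      ((metric (gen .H) (s.1 0 φ) : ℝ) : ℂ) = (1 : LoopFun) φ := by
    simp [metric, s.2.1.2]
  simp only [asymptoticCharge, chargeMode, h]
  rw [← I_apply, I_one]
  have : (Real.pi : ℂ) ≠ 0 := Complex.ofReal_ne_zero.2 Real.pi_ne_zero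
  push_cast
  field_simp

theorem chargeMap_asymptoticGen (μ : ℝ → ℝ → ℝ) (k : ℝ) (X : AsymptoticGen) :
    chargeMap μ k (X.param k) = asymptoticCharge μ k X := by
  funext s
  rw [chargeMap_apply]
  rcases X with _ | _ | ⟨a, n⟩ | ⟨a, n⟩
  · have h : (AsymptoticGen.param k .H).density s.1 s.2.1.1 = 0 := by
      ext φ
      simp [ChargeParam.density_apply, AsymptoticGen.param]
    rw [h, map_zero, mul_zero, add_zero, asymptoticCharge_H]
    rfl
  · have h : (AsymptoticGen.param k .J).density s.1 s.2.1.1 = -s.1.loop s.2.1.1 .H := by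
      ext φ
      simp [ChargeParam.density_apply, AsymptoticGen.param, BoundaryField.loop_apply]
    rw [h, asymptoticCharge_J]
    exact zero_add _
  · have h : (AsymptoticGen.param k (.P a n)).density s.1 s.2.1.1
        = E n * s.1.loop s.2.1.1 (.G a) := by
      ext φ
      fin_cases a <;>
        simp [ChargeParam.density_apply, AsymptoticGen.param, BoundaryField.loop_apply]
    rw [h, asymptoticCharge_P]
    exact zero_add _
  · have h : (AsymptoticGen.param k (.G a n)).density s.1 s.2.1.1
        = E n * s.1.loop s.2.1.1 (.P a) := by
      ext φ
      fin_cases a <;>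
        simp [ChargeParam.density_apply, AsymptoticGen.param, BoundaryField.loop_apply]
    rw [h, asymptoticCharge_G]
    exact zero_add _

/-- Parseval for each pair of dual components. The constant `Λ^J` needs no expansion, so its term is
moved to the other side. -/
theorem hasSum_charge {μ : ℝ → ℝ → ℝ} (k : ℝ) {Λ : BoundaryField} (hΛ : Admissible μ Λ)
    (s : SolutionSpace μ) :
    HasSum (fun n : ℤ => ∑ c,
        (parameterMode Λ (.P c) n * asymptoticCharge μ k (.P c n) s
          + parameterMode Λ (.G c) n * asymptoticCharge μ k (.G c n) s))
      (chargeFunctional μ k Λ s - (Λ 0 0 .J : ℂ) * asymptoticCharge μ k .J s) := by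
  have h := (hasSum_sum (s := Finset.univ) fun (c : Fin 2) _ =>
    ((hasSum_I_mul_I (Λ.loop hΛ.1 (.P c)) (s.1.loop s.2.1.1 (.G c))).add
      (hasSum_I_mul_I (Λ.loop hΛ.1 (.G c)) (s.1.loop s.2.1.1 (.P c))))).mul_left
        ((k / (2 * Real.pi) : ℝ) : ℂ)
  have hd : (Λ.param hΛ.1).density s.1 s.2.1.1 = (Λ 0 0 .J : ℂ) • (-s.1.loop s.2.1.1 .H)
      + ∑ c, (Λ.loop hΛ.1 (.P c) * s.1.loop s.2.1.1 (.G c)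
        + Λ.loop hΛ.1 (.G c) * s.1.loop s.2.1.1 (.P c)) := by
    rw [smul_neg]
    rfl
  have hv : chargeFunctional μ k Λ s - (Λ 0 0 .J : ℂ) * asymptoticCharge μ k .J s
      = ((k / (2 * Real.pi) : ℝ) : ℂ) * ∑ c, (I (Λ.loop hΛ.1 (.P c) * s.1.loop s.2.1.1 (.G c))
        + I (Λ.loop hΛ.1 (.G c) * s.1.loop s.2.1.1 (.P c))) := by
    rw [← chargeMap_param k hΛ, chargeMap_apply, hd, asymptoticCharge_J, map_add, map_smul, map_sum,
      smul_eq_mul]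
    simp only [map_add, BoundaryField.param]
    ring
  rw [hv]
  refine (congrArg (HasSum · _) (funext fun n => ?_)).mp h
  rw [Finset.mul_sum]
  refine Finset.sum_congr rfl fun c _ => ?_
  rw [parameterMode_eq Λ hΛ.1, parameterMode_eq Λ hΛ.1, asymptoticCharge_P, asymptoticCharge_G]
  ring

/-- The functionals dual to the parameters of the generators. -/
noncomputable def AsymptoticGen.dual (k : ℝ) : AsymptoticGen → Module.Dual ℂ ChargeParam
  | .H => (k : ℂ)⁻¹ • LinearMap.fst ℂ ℂ (ℂ × LoopPair)
  | .J => LinearMap.fst ℂ ℂ LoopPair ∘ₗ LinearMap.snd ℂ ℂ (ℂ × LoopPair)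
  | .P a n => (2 * Real.pi : ℂ)⁻¹ • (I ∘ₗ LinearMap.mulLeft ℂ (E (-n)) ∘ₗ LinearMap.proj a ∘ₗ
      LinearMap.fst ℂ (Fin 2 → LoopFun) (Fin 2 → LoopFun) ∘ₗ LinearMap.snd ℂ ℂ LoopPair ∘ₗ
        LinearMap.snd ℂ ℂ (ℂ × LoopPair))
  | .G a n => (2 * Real.pi : ℂ)⁻¹ • (I ∘ₗ LinearMap.mulLeft ℂ (E (-n)) ∘ₗ LinearMap.proj a ∘ₗ
      LinearMap.snd ℂ (Fin 2 → LoopFun) (Fin 2 → LoopFun) ∘ₗ LinearMap.snd ℂ ℂ LoopPair ∘ₗ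
        LinearMap.snd ℂ ℂ (ℂ × LoopPair))

theorem I_E_mul_single (a b : Fin 2) (n m : ℤ) :
    (2 * Real.pi : ℂ)⁻¹ * I (E (-n) * (Pi.single b (E m) : Fin 2 → LoopFun) a)
      = if a = b ∧ n = m then 1 else 0 := by
  have hpi : (2 * Real.pi : ℂ) ≠ 0 := by exact_mod_cast Real.two_pi_pos.ne'
  by_cases hab : a = b
  · subst hab
    rw [Pi.single_eq_same, E_mul, I_E]
    have h : -n + m = 0 ↔ n = m := by omega
    simp only [h, true_and]
    split_ifs
    · exact inv_mul_cancel₀ hpi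
    · exact mul_zero _
  · simp [hab]

/-- Orthogonality of exponentials makes `AsymptoticGen.dual` biorthogonal to the parameters; `k ≠ 0`
normalises the functional for `H`. -/
theorem linearIndependent_param {k : ℝ} (hk : k ≠ 0) :
    LinearIndependent ℂ (AsymptoticGen.param k) := by
  have hk' : (k : ℂ) ≠ 0 := Complex.ofReal_ne_zero.2 hk
  refine .of_pairwise_dual_eq_zero_one _ (AsymptoticGen.dual k) (fun X Y hXY => ?_) fun X => ?_
  · rcases X with _ | _ | ⟨a, n⟩ | ⟨a, n⟩ <;> rcases Y with _ | _ | ⟨b, m⟩ | ⟨b, m⟩ <;>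
      simp [AsymptoticGen.dual, AsymptoticGen.param] at hXY ⊢
    all_goals
      refine (mul_eq_zero.1 ?_).resolve_left
        (inv_ne_zero (Complex.ofReal_ne_zero.2 Real.two_pi_pos.ne'))
      push_cast
      rw [I_E_mul_single, if_neg fun h => hXY h.1 h.2]
  · rcases X with _ | _ | ⟨a, n⟩ | ⟨a, n⟩
    · simp [AsymptoticGen.dual, AsymptoticGen.param, hk']
    · simp [AsymptoticGen.dual, AsymptoticGen.param]
    · exact (I_E_mul_single a a n n).trans (if_pos ⟨rfl, rfl⟩)
    · exact (I_E_mul_single a a n n).trans (if_pos ⟨rfl, rfl⟩)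

/-! ### Brackets of the generators -/

theorem paramBracket_apply (k : ℝ) (x y : ChargeParam) : paramBracket k x y
    = (loopCocycle k x.2.2 y.2.2, 0, x.2.1 • loopRotation y.2.2 - y.2.1 • loopRotation x.2.2) := rfl

theorem paramBracket_J_P (k : ℝ) (a : Fin 2) (n : ℤ) :
    paramBracket k (AsymptoticGen.param k .J) (AsymptoticGen.param k (.P a n))
      = ∑ b, (eps a b : ℂ) • AsymptoticGen.param k (.P b n) := by
  rw [paramBracket_apply, Fin.sum_univ_two]
  refine Prod.ext ?_ (Prod.ext ?_ (Prod.ext (funext fun c => ?_) (funext fun c => ?_)))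
  · simp [AsymptoticGen.param]
  · simp [AsymptoticGen.param]
  · fin_cases a <;> fin_cases c <;> simp [AsymptoticGen.param, loopRotation, eps]
  · simp [AsymptoticGen.param, loopRotation]

theorem paramBracket_J_G (k : ℝ) (a : Fin 2) (n : ℤ) :
    paramBracket k (AsymptoticGen.param k .J) (AsymptoticGen.param k (.G a n))
      = ∑ b, (eps a b : ℂ) • AsymptoticGen.param k (.G b n) := by
  rw [paramBracket_apply, Fin.sum_univ_two]
  refine Prod.ext ?_ (Prod.ext ?_ (Prod.ext (funext fun c => ?_) (funext fun c => ?_)))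
  · simp [AsymptoticGen.param]
  · simp [AsymptoticGen.param]
  · simp [AsymptoticGen.param, loopRotation]
  · fin_cases a <;> fin_cases c <;> simp [AsymptoticGen.param, loopRotation, eps]

/-- Differentiating `E n` produces `-in`, and `∮ E n * E m` is `2π` or `0`; with the prefactor `k /
2π` this leaves the constant `k`, the parameter of `H`. -/
theorem paramBracket_P_G (k : ℝ) (a b : Fin 2) (n m : ℤ) :
    paramBracket k (AsymptoticGen.param k (.P a n)) (AsymptoticGen.param k (.G b m))
      = (-((eps a b : ℂ) + Complex.I * n * (if a = b then 1 else 0))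
          * (if n + m = 0 then 1 else 0)) • AsymptoticGen.param k .H := by
  have hI : I (E n * E m) = if n + m = 0 then 2 * (Real.pi : ℂ) else 0 := by
    rw [E_mul, I_E]
  have hD : I (E m * D (E n)) = -(Complex.I * n) * I (E n * E m) := by
    rw [D_E, mul_smul_comm, map_smul, smul_eq_mul, mul_comm (E m)]
  have hpi : (Real.pi : ℂ) ≠ 0 := Complex.ofReal_ne_zero.2 Real.pi_ne_zero
  have hω : loopCocycle k (AsymptoticGen.param k (.P a n)).2.2 (AsymptoticGen.param k (.G b m)).2.2
      = ((k / (2 * Real.pi) : ℝ) : ℂ) *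
        ((if a = b then I (E m * D (E n)) else 0) - (eps a b : ℂ) * I (E n * E m)) := by
    rw [loopCocycle_apply]
    fin_cases a <;> fin_cases b <;> simp [AsymptoticGen.param, eps]
  rw [paramBracket_apply, hω, hD, hI]
  refine Prod.ext ?_ (Prod.ext ?_ ?_)
  · simp only [AsymptoticGen.param, Prod.smul_fst, smul_eq_mul]
    push_cast
    split_ifs <;> field_simp <;> ring
  · simp only [AsymptoticGen.param, Prod.smul_fst, Prod.smul_snd, smul_zero]
  · simp only [AsymptoticGen.param, Prod.smul_snd, smul_zero, zero_smul, sub_zero]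

theorem paramBracket_P_P (k : ℝ) (a b : Fin 2) (n m : ℤ) :
    paramBracket k (AsymptoticGen.param k (.P a n)) (AsymptoticGen.param k (.P b m)) = 0 := by
  simp [paramBracket_apply, AsymptoticGen.param, loopCocycle_apply]

theorem paramBracket_G_G (k : ℝ) (a b : Fin 2) (n m : ℤ) :
    paramBracket k (AsymptoticGen.param k (.G a n)) (AsymptoticGen.param k (.G b m)) = 0 := by
  simp [paramBracket_apply, AsymptoticGen.param, loopCocycle_apply]

theorem paramBracket_H (k : ℝ) (x : ChargeParam) :
    paramBracket k (AsymptoticGen.param k .H) x = 0 := by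
  simp [paramBracket_apply, AsymptoticGen.param]

/-- The zero modes. -/
noncomputable def zeroModeParam (k : ℝ) : Carroll ℂ →ₗ[ℂ] ChargeParam where
  toFun x := (k * x .H, x .J, fun a => x (.P a) • 1, fun a => x (.G a) • 1)
  map_add' x y := by
    simp only [add_coeff, mul_add, add_smul]
    rfl
  map_smul' c x := by
    simp only [smul_coeff, mul_smul, mul_left_comm _ c]
    rfl

theorem zeroModeParam_apply (k : ℝ) (x : Carroll ℂ) : zeroModeParam k x
    = (k * x .H, x .J, fun a => x (.P a) • 1, fun a => x (.G a) • 1) := rfl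

theorem zeroModeParam_injective {k : ℝ} (hk : k ≠ 0) : Function.Injective (zeroModeParam k) := by
  intro x y h
  rw [zeroModeParam_apply, zeroModeParam_apply, Prod.mk.injEq, Prod.mk.injEq, Prod.mk.injEq] at h
  obtain ⟨hH, hJ, hP, hG⟩ := h
  have hone {z z' : ℂ} (hz : z • (1 : LoopFun) = z' • (1 : LoopFun)) : z = z' := by
    simpa using congrArg (fun f : LoopFun => f 0) hz
  ext X
  rcases X with _ | c | _ | c
  · exact mul_left_cancel₀ (Complex.ofReal_ne_zero.2 hk) hH
  · exact hone (congrFun hP c)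
  · exact hJ
  · exact hone (congrFun hG c)

/-- On constant loops the derivative part of the cocycle vanishes, leaving the `ε` term of the
Carroll bracket. -/
theorem zeroModeParam_lie (k : ℝ) (x y : Carroll ℂ) :
    zeroModeParam k ⁅x, y⁆ = paramBracket k (zeroModeParam k x) (zeroModeParam k y) := by
  have hpi : (Real.pi : ℂ) ≠ 0 := Complex.ofReal_ne_zero.2 Real.pi_ne_zero
  rw [paramBracket_apply]
  simp only [zeroModeParam_apply]
  refine Prod.ext ?_ (Prod.ext ?_ (Prod.ext (funext fun c => ?_) (funext fun c => ?_)))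
  · simp [loopCocycle_apply, bracket_H, D_one, Fin.sum_univ_two, eps, I_one]
    field_simp
  · simp [bracket_J]
  · ext φ
    fin_cases c <;> simp [loopRotation, bracket_P, eps] <;> ring
  · ext φ
    fin_cases c <;> simp [loopRotation, bracket_G, eps] <;> ring

theorem zeroModeParam_gen_H (k : ℝ) :
    zeroModeParam k (gen .H) = AsymptoticGen.param k .H := by
  simp [zeroModeParam_apply, AsymptoticGen.param]
  rfl

theorem zeroModeParam_gen_J (k : ℝ) :
    zeroModeParam k (gen .J) = AsymptoticGen.param k .J := by
  simp [zeroModeParam_apply, AsymptoticGen.param]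
  rfl

theorem zeroModeParam_gen_P (k : ℝ) (a : Fin 2) :
    zeroModeParam k (gen (.P a)) = AsymptoticGen.param k (.P a 0) := by
  refine Prod.ext ?_ (Prod.ext ?_ (Prod.ext (funext fun c => ?_) (funext fun c => ?_))) <;>
    fin_cases a <;> (try fin_cases c) <;>
      simp [zeroModeParam_apply, AsymptoticGen.param, E_zero]

theorem zeroModeParam_gen_G (k : ℝ) (a : Fin 2) :
    zeroModeParam k (gen (.G a)) = AsymptoticGen.param k (.G a 0) := by
  refine Prod.ext ?_ (Prod.ext ?_ (Prod.ext (funext fun c => ?_) (funext fun c => ?_))) <;>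
    fin_cases a <;> (try fin_cases c) <;>
      simp [zeroModeParam_apply, AsymptoticGen.param, E_zero]

/-! ### The Dirac bracket -/

section

variable {μ : ℝ → ℝ → ℝ} (hμ : ContDiff ℝ ∞ (fun z : ℝ × ℝ => μ z.1 z.2))
  (hμper : ∀ t φ : ℝ, μ t (φ + 2 * Real.pi) = μ t φ)

/-- The functionals in the span of the charges are parametrized by `ChargeParam`. -/
noncomputable def chargeEquiv {k : ℝ} (hk : k ≠ 0) : ChargeParam ≃ₗ[ℂ] ChargeSpace μ k :=
  (LinearEquiv.ofInjective _ (chargeMap_injective hμ hμper hk)).trans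
    (LinearEquiv.ofEq _ _ (range_chargeMap μ k))

theorem coe_chargeEquiv {k : ℝ} (hk : k ≠ 0) (x : ChargeParam) :
    (chargeEquiv hμ hμper hk x : SolutionSpace μ → ℂ) = chargeMap μ k x := rfl

/-- The Dirac bracket of the charges. -/
noncomputable def diracBracket {k : ℝ} (hk : k ≠ 0) :
    ChargeSpace μ k →ₗ[ℂ] ChargeSpace μ k →ₗ[ℂ] ChargeSpace μ k :=
  ((paramBracket k).compl₁₂ (chargeEquiv hμ hμper hk).symm.toLinearMap
    (chargeEquiv hμ hμper hk).symm.toLinearMap).compr₂ (chargeEquiv hμ hμper hk).toLinearMap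

theorem diracBracket_apply {k : ℝ} (hk : k ≠ 0) (x y : ChargeParam) :
    diracBracket hμ hμper hk (chargeEquiv hμ hμper hk x) (chargeEquiv hμ hμper hk y)
      = chargeEquiv hμ hμper hk (paramBracket k x y) := by
  simp [diracBracket]

theorem isDiracBracket_diracBracket {k : ℝ} (hk : k ≠ 0) :
    IsDiracBracket μ k (diracBracket hμ hμper hk) where
  alternating F := by
    obtain ⟨x, rfl⟩ := (chargeEquiv hμ hμper hk).surjective F
    rw [diracBracket_apply, paramBracket, doubleExtensionBracket_self (loopCocycle_self k),
      map_zero]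
  jacobi F₁ F₂ F₃ := by
    obtain ⟨x, rfl⟩ := (chargeEquiv hμ hμper hk).surjective F₁
    obtain ⟨y, rfl⟩ := (chargeEquiv hμ hμper hk).surjective F₂
    obtain ⟨z, rfl⟩ := (chargeEquiv hμ hμper hk).surjective F₃
    simp only [diracBracket_apply, ← map_add]
    congr 1
    exact doubleExtensionBracket_jacobi (loopCocycle_self k) (loopCocycle_rotation k) x y z
  generates Λ hΛ Q hQ F := by
    obtain ⟨x, rfl⟩ := (chargeEquiv hμ hμper hk).surjective F
    have h : Q = chargeEquiv hμ hμper hk (Λ.param hΛ.1) :=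
      Subtype.ext (hQ.trans (chargeMap_param k hΛ).symm)
    rw [h, diracBracket_apply, coe_chargeEquiv, coe_chargeEquiv]
    exact hasGaugeVariation_chargeMap k hΛ x

include hμ hμper in
-- The definition quantifies over curves of solutions; admissible transformations supply such a
-- curve through every solution, so it is never vacuous.
theorem HasGaugeVariation.unique {Λ : BoundaryField} (hΛ : Admissible μ Λ)
    {F F' F'' : SolutionSpace μ → ℂ} (h' : HasGaugeVariation μ Λ F F')
    (h'' : HasGaugeVariation μ Λ F F'') : F' = F'' := by
  funext a
  let c : ℝ → SolutionSpace μ := fun ε =>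
    ⟨a.1 + ε • boundaryVariation Λ a.1, a.2.add_smul_boundaryVariation hμ hμper hΛ ε⟩
  exact (h' a c fun _ => rfl).unique (h'' a c fun _ => rfl)

theorem hasGaugeVariation_one (μ : ℝ → ℝ → ℝ) (Λ : BoundaryField) : HasGaugeVariation μ Λ 1 0 :=
  fun _ _ _ => hasDerivAt_const _ _

include hμ hμper in
theorem IsDiracBracket.one_left {k : ℝ}
    {br : ChargeSpace μ k →ₗ[ℂ] ChargeSpace μ k →ₗ[ℂ] ChargeSpace μ k}
    (h : IsDiracBracket μ k br) (F : ChargeSpace μ k) :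
    br ⟨1, one_mem_chargeSpace μ k⟩ F = 0 := by
  obtain ⟨F, hF⟩ := F
  induction hF using Submodule.span_induction with
  | mem F hF =>
    obtain rfl | ⟨Λ, hΛ, rfl⟩ := hF
    · exact h.alternating _
    -- The axiom only governs charges on the left; antisymmetry brings the charge there, and a
    -- constant has zero gauge variation.
    · rw [← LinearMap.IsAlt.neg h.alternating, neg_eq_zero]
      exact Subtype.ext (HasGaugeVariation.unique hμ hμper hΛ (h.generates Λ hΛ _ rfl _)
        (hasGaugeVariation_one μ Λ))
  | zero => exact map_zero (br _)
  | add x y hx hy ihx ihy =>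
    exact (map_add (br _) ⟨x, hx⟩ ⟨y, hy⟩).trans
      ((congrArg₂ (· + ·) ihx ihy).trans (add_zero 0))
  | smul c x hx ih =>
    exact (map_smul (br _) c ⟨x, hx⟩).trans ((congrArg (c • ·) ih).trans (smul_zero c))

include hμ hμper in
theorem IsDiracBracket.unique {k : ℝ}
    {br br' : ChargeSpace μ k →ₗ[ℂ] ChargeSpace μ k →ₗ[ℂ] ChargeSpace μ k}
    (h : IsDiracBracket μ k br) (h' : IsDiracBracket μ k br') : br = br' := by
  refine LinearMap.ext fun Q => ?_
  obtain ⟨Q, hQ⟩ := Q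
  induction hQ using Submodule.span_induction with
  | mem Q hQ =>
    refine LinearMap.ext fun F => ?_
    obtain rfl | ⟨Λ, hΛ, rfl⟩ := hQ
    · exact (h.one_left hμ hμper F).trans (h'.one_left hμ hμper F).symm
    · exact Subtype.ext (HasGaugeVariation.unique hμ hμper hΛ (h.generates Λ hΛ _ rfl F)
        (h'.generates Λ hΛ _ rfl F))
  | zero => exact (map_zero br).trans (map_zero br').symm
  | add x y hx hy ihx ihy =>
    exact (map_add br ⟨x, hx⟩ ⟨y, hy⟩).trans
      ((congrArg₂ (· + ·) ihx ihy).trans (map_add br' ⟨x, hx⟩ ⟨y, hy⟩).symm)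
  | smul c x hx ih =>
    exact (map_smul br c ⟨x, hx⟩).trans
      ((congrArg (c • ·) ih).trans (map_smul br' c ⟨x, hx⟩).symm)

end

/-! ### The main theorem. -/

theorem mainTheorem5 (k : ℝ) (hk : k ≠ 0) (μ : ℝ → ℝ → ℝ)
    (hμ : ContDiff ℝ ∞ (fun z : ℝ × ℝ => μ z.1 z.2))
    (hμper : ∀ t φ : ℝ, μ t (φ + 2 * Real.pi) = μ t φ) :
    -- the boundary terms are canonical: they make the generators of gauge transformations
    -- differentiable
    (∀ (A δA : OneForm) (Λ : BulkField), (∀ i, (A i).SmoothPeriodic) →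
      (∀ i, (δA i).SmoothPeriodic) → Λ.SmoothPeriodic → ∀ t r R : ℝ,
        HasDerivAt (fun ε : ℝ => smearedConstraint k t r R Λ (A + ε • δA))
          (symplecticForm k t r R (gaugeVariation A Λ) δA
            - (chargeVariation k t R Λ δA - chargeVariation k t r Λ δA)) 0) ∧
    -- the field equations
    (∀ a : BoundaryField, OnShell μ a ↔ IsState a ∧ ∀ t φ : ℝ,
      (∀ c, deriv (fun u => a u φ (.P c)) t = 0 ∧ deriv (fun u => a u φ (.G c)) t = 0) ∧
        deriv (fun u => a u φ .H) t = deriv (fun u => μ t u) φ) ∧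
    -- the boundary condition preserving gauge transformations
    (∀ Λ : BoundaryField, Admissible μ Λ ↔ Λ.SmoothPeriodic ∧
      (∀ t t' φ : ℝ, Λ t φ = Λ t' φ) ∧ ∀ t φ φ' : ℝ, Λ t φ .J = Λ t φ' .J) ∧
    (∀ Λ : BoundaryField, Admissible μ Λ → ∀ a, IsState a →
      gaugeVariation (connection μ a) (dressed Λ)
        = connectionVariation (boundaryVariation Λ a)) ∧
    (∀ Λ : BoundaryField, Admissible μ Λ → ∀ a, OnShell μ a →
      ∀ ε : ℝ, OnShell μ (a + ε • boundaryVariation Λ a)) ∧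
    -- the charges are finite and integrable
    (∀ Λ : BoundaryField, Admissible μ Λ → ∀ a, IsState a → ∀ δ, IsVariation δ → ∀ t : ℝ,
      ∃ q : ℝ, (∀ ρ, chargeVariation k t ρ (dressed Λ) (connectionVariation δ) = q) ∧
        Tendsto (fun ρ => chargeVariation k t ρ (dressed Λ) (connectionVariation δ)) atTop (𝓝 q) ∧
        HasDerivAt (fun ε : ℝ => charge k Λ t (a + ε • δ)) q 0) ∧
    -- the charges are conserved
    (∀ Λ : BoundaryField, Admissible μ Λ → ∀ a, OnShell μ a →
      ∀ t t' : ℝ, charge k Λ t a = charge k Λ t' a) ∧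
    -- the charges are non-trivial
    (∀ Λ : BoundaryField, Admissible μ Λ →
      ((∀ a b : BoundaryField, OnShell μ a → OnShell μ b → charge k Λ 0 a = charge k Λ 0 b) ↔
        ∀ t φ : ℝ, Λ t φ .J = 0 ∧ ∀ c, Λ t φ (.P c) = 0 ∧ Λ t φ (.G c) = 0)) ∧
    -- the Dirac bracket of the charges, and the asymptotic symmetry algebra
    ∃ (br : ChargeSpace μ k →ₗ[ℂ] ChargeSpace μ k →ₗ[ℂ] ChargeSpace μ k)
      (T : AsymptoticGen → ChargeSpace μ k),
      IsDiracBracket μ k br ∧ (∀ br', IsDiracBracket μ k br' → br' = br) ∧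
      (∀ X, (T X : SolutionSpace μ → ℂ) = asymptoticCharge μ k X) ∧
      (∀ Λ : BoundaryField, Admissible μ Λ → ∀ s : SolutionSpace μ,
        HasSum (fun n : ℤ => ∑ c,
            (parameterMode Λ (.P c) n * asymptoticCharge μ k (.P c n) s
              + parameterMode Λ (.G c) n * asymptoticCharge μ k (.G c n) s))
          (chargeFunctional μ k Λ s - (Λ 0 0 .J : ℂ) * asymptoticCharge μ k .J s)) ∧
      LinearIndependent ℂ T ∧
      (∀ a n, br (T .J) (T (.P a n)) = ∑ b, (eps a b : ℂ) • T (.P b n)) ∧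
      (∀ a n, br (T .J) (T (.G a n)) = ∑ b, (eps a b : ℂ) • T (.G b n)) ∧
      (∀ a b n m, br (T (.P a n)) (T (.G b m)) =
        (-((eps a b : ℂ) + Complex.I * n * (if a = b then 1 else 0))
          * (if n + m = 0 then 1 else 0)) • T .H) ∧
      (∀ a b n m, br (T (.P a n)) (T (.P b m)) = 0) ∧
      (∀ a b n m, br (T (.G a n)) (T (.G b m)) = 0) ∧
      (∀ X, br (T .H) (T X) = 0) ∧
      -- the zero modes form a copy of the Carroll algebra
      ∃ ι : Carroll ℂ →ₗ[ℂ] ChargeSpace μ k, Function.Injective ι ∧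
        (∀ x y, ι ⁅x, y⁆ = br (ι x) (ι y)) ∧
        ι (Carroll.gen .H) = T .H ∧ ι (Carroll.gen .J) = T .J ∧
        (∀ a, ι (Carroll.gen (.P a)) = T (.P a 0)) ∧
        ∀ a, ι (Carroll.gen (.G a)) = T (.G a 0) := by
  have hbr := isDiracBracket_diracBracket hμ hμper hk
  -- Transport along `chargeEquiv` reduces every bracket of functionals to one of parameters.
  have happly := diracBracket_apply hμ hμper hk
  refine ⟨fun A δA Λ hA hδ hΛ t r R => hasDerivAt_smearedConstraint k hA hδ hΛ t r R,
    onShell_iff hμ hμper, admissible_iff μ, fun Λ hΛ a _ => hΛ.gaugeVariation_eq a,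
    fun Λ hΛ a ha ε => ha.add_smul_boundaryVariation hμ hμper hΛ ε,
    fun Λ hΛ a ha δ hδ t => charge_finite_integrable k hΛ.1 ha.1 hδ t,
    fun Λ hΛ a ha t t' => charge_conserved hμ hμper k hΛ ha t t',
    fun Λ hΛ => charge_constant_iff hμ hμper hk hΛ,
    diracBracket hμ hμper hk, fun X => chargeEquiv hμ hμper hk (X.param k), hbr,
    fun br' h => h.unique hμ hμper hbr,
    fun X => chargeMap_asymptoticGen μ k X, fun Λ hΛ s => hasSum_charge k hΛ s, ?_, ?_, ?_, ?_, ?_,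
    ?_, ?_, (chargeEquiv hμ hμper hk).toLinearMap ∘ₗ zeroModeParam k, ?_, ?_, ?_, ?_, ?_, ?_⟩
  · exact (linearIndependent_param hk).map' (chargeEquiv hμ hμper hk).toLinearMap
      (LinearEquiv.ker _)
  · intro a n
    simp only [happly, paramBracket_J_P, map_sum, map_smul]
  · intro a n
    simp only [happly, paramBracket_J_G, map_sum, map_smul]
  · intro a b n m
    simp only [happly, paramBracket_P_G, map_smul]
  · intro a b n m
    simp only [happly, paramBracket_P_P, map_zero]
  · intro a b n m
    simp only [happly, paramBracket_G_G, map_zero]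
  · intro X
    simp only [happly, paramBracket_H, map_zero]
  · exact (chargeEquiv hμ hμper hk).injective.comp (zeroModeParam_injective hk)
  · intro x y
    simp only [LinearMap.comp_apply, LinearEquiv.coe_coe, happly, zeroModeParam_lie]
  · exact congrArg (chargeEquiv hμ hμper hk) (zeroModeParam_gen_H k)
  · exact congrArg (chargeEquiv hμ hμper hk) (zeroModeParam_gen_J k)
  · exact fun a => congrArg (chargeEquiv hμ hμper hk) (zeroModeParam_gen_P k a)
  · exact fun a => congrArg (chargeEquiv hμ hμper hk) (zeroModeParam_gen_G k a)
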